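/- Let $D\ge 1$ be an integer and let $\Phi=(\Phi_1,\dots,\Phi_D)$ be a probability distribution on $\{1,\dots,D\}$ with $\sum_{d\text{ odd}}\Phi_d>0$; $D$ and $\Phi$ do not depend on $m$. For each $m$ let there be $w\ge 1$ workers and error probabilities $\epsilon_{k,d}$ ($1\le k\le w$, $1\le d\le D$). The number $w$ and the $\epsilon_{k,d}$ may depend on $m$, and there is a constant $\lambda>0$, independent of $m$, with $\lambda\le\epsilon_{k,d}\le\frac12-\lambda$ for all $k,d$. (If $w$ and the $\epsilon_{k,d}$ do not depend on $m$, this just says that $0<\epsilon_{k,d}<\frac12$.) A label vector $\mathbf{x}\in\{1,-1\}^m$ is to be recovered from $n$ queries. Independently for each query, a degree $d$ is drawn from $\Phi$, then a set $S$ of $d$ labels is drawn uniformly among the $\binom md$ possibilities, and the query is assigned to a worker $k$ drawn uniformly from the $w$ workers. The worker answers with the XOR $\prod_{i\in S}x_i$ with probability $1-\epsilon_{k,d}$ and with its negative with probability $\epsilon_{k,d}$. An estimator is a function $\hat{\mathbf{x}}$ of the $n$ observed sets, workers and answers (it may depend on $\Phi$ and on the $\epsilon_{k,d}$). A maximum likelihood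 (ML) estimator is one that maximizes the likelihood of the observations over $\{1,-1\}^m$, with ties resolved arbitrarily. Put $$T_m=\frac{m\log m}{\sum_{d=1}^D\sum_{k=1}^w\frac{d\,\Phi_d}{w}\bigl(\sqrt{1-\epsilon_{k,d}}-\sqrt{\epsilon_{k,d}}\bigr)^2}.$$ Then for every constant $\eta>0$: (0) For all $m\ge D$ and all $n$, every ML estimator minimizes $\Pr[\hat{\mathbf{x}}\ne\mathbf{x}]$ for uniformly distributed $\mathbf{x}$ among all estimators. (1) If $n=n_m\ge(1+\eta)T_m$ for all large $m$, then for every choice of ML estimators $\max_{\mathbf{x}}\Pr_{\mathbf{x}}[\hat{\mathbf{x}}\ne\mathbf{x}]\to0$ as $m\to\infty$, where the maximum is over all ground truths $\mathbf{x}\in\{1,-1\}^m$. (2) If for some choice of $n=n_m$ and of estimators (ML or not) $\Pr[\hat{\mathbf{x}}\ne\mathbf{x}]\to0$ as $m\to\infty$ for uniformly distributed $\mathbf{x}$, then $n_m>(1-\eta)T_m$ for all large $m$. In particular, exact recovery is impossible if $n_m\le(1-\eta)T_m$. -/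

import Mathlib

open Filter Topology

namespace XorQuery

/-- Label vectors `x ∈ {1, -1}^m`. -/
abbrev Labels (m : ℕ) : Type := Fin m → ℤˣ

/-- What is observed about one query: the set of queried labels, the worker to whom the query is
assigned, and the answer of the worker. -/
abbrev Obs (m w : ℕ) : Type := Finset (Fin m) × Fin w × ℤˣ

/-- What is observed about `n` queries. -/
abbrev Data (m w n : ℕ) : Type := Fin n → Obs m w

/-- The correct answer to the XOR query on the set `S`; in the `±1` encoding the XOR of labels is
their product. -/
def xorAnswer {m : ℕ} (x : Labels m) (S : Finset (Fin m)) : ℤˣ := ∏ i ∈ S, x i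

/-- The probability that a query is on the set `S`: its degree `d ∈ {1, …, D}` is drawn from the
distribution `Φ`, and then one of the `m.choose d` sets of `d` labels is drawn uniformly. -/
noncomputable def queryProb (D : ℕ) (Φ : ℕ → ℝ) {m : ℕ} (S : Finset (Fin m)) : ℝ :=
  if S.card ∈ Finset.Icc 1 D then Φ S.card / (m.choose S.card : ℝ) else 0

/-- The probability of the answer `y` when the correct answer is `c` and the error probability
is `e`. -/
noncomputable def answerProb (e : ℝ) (c y : ℤˣ) : ℝ := if y = c then 1 - e else e

/-- The probability, under the ground truth `x`, that a query is on the set `q.1`, is assigned to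
the worker `q.2.1` (uniform among the `w` workers) and receives the answer `q.2.2`. Here `ε k d` is
the error probability of worker `k` on queries of degree `d`. -/
noncomputable def obsProb (D : ℕ) (Φ : ℕ → ℝ) {m w : ℕ} (ε : Fin w → ℕ → ℝ) (x : Labels m)
    (q : Obs m w) : ℝ :=
  queryProb D Φ q.1 * (1 / (w : ℝ)) * answerProb (ε q.2.1 q.1.card) (xorAnswer x q.1) q.2.2

/-- The probability of the data `z` under the ground truth `x`: the `n` queries, their workers and
their answers are independent. -/
noncomputable def likelihood (D : ℕ) (Φ : ℕ → ℝ) {m w n : ℕ} (ε : Fin w → ℕ → ℝ) (x : Labels m)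
    (z : Data m w n) : ℝ :=
  ∏ j, obsProb D Φ ε x (z j)

/-- A maximum likelihood estimator (for known `ε`, with arbitrary resolution of ties). -/
def IsML (D : ℕ) (Φ : ℕ → ℝ) {m w n : ℕ} (ε : Fin w → ℕ → ℝ)
    (est : Data m w n → Labels m) : Prop :=
  ∀ (z : Data m w n) (v : Labels m), likelihood D Φ ε v z ≤ likelihood D Φ ε (est z) z

/-- The probability, under the ground truth `x`, that the estimate differs from `x`. -/
noncomputable def errorProb (D : ℕ) (Φ : ℕ → ℝ) {m w n : ℕ} (ε : Fin w → ℕ → ℝ)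
    (est : Data m w n → Labels m) (x : Labels m) : ℝ :=
  ∑ z : Data m w n, if est z ≠ x then likelihood D Φ ε x z else 0

/-- The error probability when the ground truth is uniformly distributed on `{1, -1}^m`. -/
noncomputable def avgErrorProb (D : ℕ) (Φ : ℕ → ℝ) {m w n : ℕ} (ε : Fin w → ℕ → ℝ)
    (est : Data m w n → Labels m) : ℝ :=
  (∑ x : Labels m, errorProb D Φ ε est x) / 2 ^ m

/-- The quantity `m log m / ∑_{d=1}^D ∑_{k=1}^w (d Φ_d / w) (√(1 - ε_{k,d}) - √ε_{k,d})²`. -/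
noncomputable def threshold (D : ℕ) (Φ : ℕ → ℝ) (m : ℕ) {w : ℕ} (ε : Fin w → ℕ → ℝ) : ℝ :=
  (m * Real.log m) /
    ∑ d ∈ Finset.Icc 1 D, ∑ k : Fin w,
      (d * Φ d / w) * (√(1 - ε k d) - √(ε k d)) ^ 2

/-- The number of workers `w m` and the error probabilities `ε m k d` may vary with `m`; then
`0 < ε m k d < 1/2` is required uniformly in `m`. For parameters that do not vary with `m` this is
just `0 < ε k d < 1/2`, see `noiseBounded_const`. -/
def NoiseBounded (D : ℕ) (w : ℕ → ℕ) (ε : ∀ m, Fin (w m) → ℕ → ℝ) : Prop :=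
  ∃ lam : ℝ, 0 < lam ∧ ∀ m, ∀ k : Fin (w m), ∀ d ∈ Finset.Icc 1 D,
    lam ≤ ε m k d ∧ ε m k d ≤ 1 / 2 - lam

theorem noiseBounded_const (D w : ℕ) (ε : Fin w → ℕ → ℝ)
    (h : ∀ k, ∀ d ∈ Finset.Icc 1 D, 0 < ε k d ∧ ε k d < 1 / 2) :
    NoiseBounded D (fun _ => w) (fun _ => ε) := by
  classical
  let s : Finset (Fin w × ℕ) := Finset.univ ×ˢ Finset.Icc 1 D
  let f : Fin w × ℕ → ℝ := fun p => min (ε p.1 p.2) (1 / 2 - ε p.1 p.2)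
  have hf : ∀ p ∈ s, 0 < f p := by
    intro p hp
    have := h p.1 p.2 (Finset.mem_product.mp hp).2
    exact lt_min this.1 (by linarith [this.2])
  obtain ⟨lam, h0, hl⟩ : ∃ lam : ℝ, 0 < lam ∧ ∀ p ∈ s, lam ≤ f p := by
    rcases s.eq_empty_or_nonempty with he | hne
    · exact ⟨1, one_pos, by simp [he]⟩
    · obtain ⟨p, hp, hmin⟩ := s.exists_min_image f hne
      exact ⟨f p, hf p hp, hmin⟩
  refine ⟨lam, h0, fun _ k d hd => ?_⟩
  have := hl (k, d) (Finset.mem_product.mpr ⟨Finset.mem_univ _, hd⟩)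
  have h1 := le_trans this (min_le_left _ _)
  have h2 := le_trans this (min_le_right _ _)
  exact ⟨h1, by dsimp only at h2; linarith⟩

end XorQuery

/-!
The log-likelihood ratio of two label vectors is a sum over the independent queries, so for the
Chernoff coefficients of the data one has `∑ z, tilt s (L x z) (L v z) = chernoffSum s x v ^ n`, where
`L` is the likelihood and `tilt s` a weighted geometric mean (`sum_tilt_likelihood`). Only queries that
meet the set `T` of labels where `x` and `v` differ in an odd number of points tell `x` from `v`, and
each of them lowers the Bhattacharyya coefficient (the case `s = 0`) by
`1 - 2 √(ε (1 - ε)) = (√(1 - ε) - √ε)²`. This gives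
`chernoffSum 0 x v = 1 - ∑ d, Φ d * gap 0 ε d * oddFraction T d` (`chernoffSum_eq`), where
`oddFraction T d` is exactly `d / m` for a single label and about `d * T.card / m` for small `T`. In
terms of `rate`, the denominator of the threshold, a single label has coefficient `1 - rate / m`.

*Optimality.* For a uniform ground truth the average success probability is, up to the factor
`2 ^ m`, the sum over the data of the likelihood of the estimate, which ML maximizes termwise.

*Achievability.* By the union bound the error probability of ML is at most the sum of the
Bhattacharyya coefficients `chernoffSum 0 x v ^ n` over `v ≠ x` (`errorProb_le_sum`). With
`n ≥ (1 + η) * threshold` the coefficient for `T.card = t` is at most `m ^ (-(1 + η / 2) * t)` if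
`t ≤ δ * m`; for larger `t` the queries of some odd degree with positive probability keep the
coefficient of one query away from `1`, so that the `n`-th power is below `exp (-2 * m)`
(`chernoffSum_pow_le`). The sum of the first bounds over all nonempty `T` is
`(1 + m ^ (-(1 + η / 2))) ^ m - 1 → 0`.

*Converse.* It is enough to compare `x` with the `m` label vectors `flipLabel x i`. Each has
Bhattacharyya coefficient `b = (1 - rate / m) ^ n` with `x`, and if `n ≤ (1 - η) * threshold` then
`m * b ≥ m ^ (η / 2)`. Consider the sum over `i` of the square roots of the likelihood ratios, each
truncated to ratios in `[M⁻¹, M]` with `M = m ^ (η / 2)`. Its mean is about `m * b`: since the tilted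
coefficients differ from the untilted one only in second order in `s` (`noiseTilt_le`), Markov's
inequality for a small power of the ratio shows that truncation costs little
(`sum_sqrt_likelihood_tail_le`). The truncation bounds the diagonal of the second moment, and off
the diagonal the terms are at most the coefficients of `flipLabel x i` and `flipLabel x j`, which are
about `b ^ 2` because few queries contain both labels (`sum_sqrt_likelihood_le`). Chebyshev's
inequality (`sum_lt_of_secondMoment`) then shows that the neighbours of `x` together are typically
much more likely than `x`, and no estimator can cope with that (`le_avgErrorProb`).
-/

namespace XorQuery

/-! ### Sets that meet a given set in an odd number of points -/

/-- The fraction of the `d`-element subsets of `Fin m` that meet `T` in an odd number of points: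
the probability that a uniformly random XOR query of degree `d` distinguishes two label vectors
that differ exactly on `T`. -/
noncomputable def oddFraction {m : ℕ} (T : Finset (Fin m)) (d : ℕ) : ℝ :=
  (((Finset.univ.powersetCard d).filter fun S => Odd (S ∩ T).card).card : ℝ) / (m.choose d : ℝ)

variable {m : ℕ}

theorem oddFraction_nonneg (T : Finset (Fin m)) (d : ℕ) : 0 ≤ oddFraction T d := by
  unfold oddFraction; positivity

/-- Sets with exactly one point in `T` already give this many sets with odd intersection. -/
theorem card_mul_choose_le_card_odd (T : Finset (Fin m)) {d : ℕ} (hd : 1 ≤ d) :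
    T.card * (m - T.card).choose (d - 1) ≤
      ((Finset.univ.powersetCard d).filter fun S => Odd (S ∩ T).card).card := by
  have hcard : (T ×ˢ (Tᶜ.powersetCard (d - 1))).card
      = T.card * (m - T.card).choose (d - 1) := by
    rw [Finset.card_product, Finset.card_powersetCard, Finset.card_compl, Fintype.card_fin]
  have hinter : ∀ p ∈ T ×ˢ (Tᶜ.powersetCard (d - 1)), insert p.1 p.2 ∩ T = {p.1} := by
    rintro ⟨i, S⟩ hp
    simp only [Finset.mem_product, Finset.mem_powersetCard] at hp
    rw [Finset.insert_inter_of_mem hp.1]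
    have : S ∩ T = ∅ := by
      rw [← Finset.disjoint_iff_inter_eq_empty]
      exact Finset.disjoint_left.mpr fun a ha => Finset.mem_compl.mp (hp.2.1 ha)
    rw [this]
    rfl
  have hdiff : ∀ p ∈ T ×ˢ (Tᶜ.powersetCard (d - 1)), insert p.1 p.2 \ T = p.2 := by
    rintro ⟨i, S⟩ hp
    simp only [Finset.mem_product, Finset.mem_powersetCard] at hp
    rw [Finset.insert_sdiff_of_mem _ hp.1, Finset.sdiff_eq_self_iff_disjoint]
    exact Finset.disjoint_left.mpr fun a ha => Finset.mem_compl.mp (hp.2.1 ha)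
  rw [← hcard]
  refine Finset.card_le_card_of_injOn (fun p => insert p.1 p.2) ?_ ?_
  · rintro p hp
    have h1 := hinter p hp
    obtain ⟨i, S⟩ := p
    simp only [Finset.coe_product, Set.mem_prod, Finset.mem_coe, Finset.mem_powersetCard] at hp
    have hi : i ∉ S := fun h => Finset.mem_compl.mp (hp.2.1 h) hp.1
    simp only [Finset.coe_filter, Finset.mem_powersetCard, Finset.subset_univ, true_and,
      Set.mem_ofPred_eq]
    refine ⟨?_, by rw [h1]; simp⟩
    rw [Finset.card_insert_of_notMem hi, hp.2.2]
    omega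
  · intro p hp q hq h
    have h1 := hinter p hp
    have h2 := hinter q hq
    have h3 := hdiff p hp
    have h4 := hdiff q hq
    simp only at h
    rw [h] at h1 h3
    rw [h1, Finset.singleton_inj] at h2
    exact Prod.ext h2 (h3.symm.trans h4)

theorem mul_choose_pred {d : ℕ} (hd : 1 ≤ d) (hdm : d ≤ m) :
    (m : ℝ) * ((m - 1).choose (d - 1) : ℝ) = (m.choose d : ℝ) * d := by
  obtain ⟨d, rfl⟩ : ∃ e, d = e + 1 := ⟨d - 1, by omega⟩
  obtain ⟨m, rfl⟩ : ∃ e, m = e + 1 := ⟨m - 1, by omega⟩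
  exact_mod_cast Nat.add_one_mul_choose_eq m d

theorem oddFraction_singleton (i : Fin m) {d : ℕ} (hd : 1 ≤ d) (hdm : d ≤ m) :
    oddFraction {i} d = d / m := by
  have hle : ((Finset.univ.powersetCard d).filter fun S => Odd (S ∩ {i}).card).card
      ≤ (m - 1).choose (d - 1) := by
    have : (m - 1).choose (d - 1) = ((Finset.univ.erase i).powersetCard (d - 1)).card := by
      simp
    rw [this]
    have hmem : ∀ S : Finset (Fin m), Odd (S ∩ {i}).card → i ∈ S := by
      intro S hS
      by_contra hi
      rw [Finset.inter_singleton_of_notMem hi] at hS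
      simp at hS
    refine Finset.card_le_card_of_injOn (fun S => S.erase i) ?_ ?_
    · intro S hS
      simp only [Finset.coe_filter, Finset.mem_powersetCard, Finset.subset_univ, true_and,
        Set.mem_ofPred_eq] at hS
      simp only [Finset.mem_coe, Finset.mem_powersetCard]
      exact ⟨Finset.erase_subset_erase _ (Finset.subset_univ _),
        by rw [Finset.card_erase_of_mem (hmem S hS.2), hS.1]⟩
    · intro S hS R hR h
      simp only [Finset.coe_filter, Set.mem_ofPred_eq] at hS hR
      simp only at h
      rw [← Finset.insert_erase (hmem S hS.2), h, Finset.insert_erase (hmem R hR.2)]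
  have hge := card_mul_choose_le_card_odd {i} hd
  rw [Finset.card_singleton, one_mul] at hge
  have hm : (0 : ℝ) < m := by exact_mod_cast (by omega : 0 < m)
  have hc : (0 : ℝ) < m.choose d := by exact_mod_cast Nat.choose_pos hdm
  rw [oddFraction, le_antisymm hle hge, div_eq_div_iff hc.ne' hm.ne', mul_comm,
    mul_choose_pred hd hdm, mul_comm]

/-- If `T` is small compared with `m`, then a random set of size `d` meets `T` in an odd number of
points with probability almost `d * T.card / m`. -/
theorem le_oddFraction (T : Finset (Fin m)) {d D : ℕ} (hd : 1 ≤ d) (hdD : d ≤ D) (hDm : D ≤ m) :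
    (d * T.card / m : ℝ) * (1 - D * (T.card + D) / m) ≤ oddFraction T d := by
  have hm : (0 : ℝ) < m := by exact_mod_cast (by omega : 0 < m)
  have hD : (1 : ℝ) ≤ D := by exact_mod_cast hd.trans hdD
  rcases lt_or_ge m (T.card + D) with hlt | hge
  · refine le_trans ?_ (oddFraction_nonneg T d)
    refine mul_nonpos_of_nonneg_of_nonpos (by positivity) ?_
    have h1 : (m : ℝ) ≤ T.card + D := by exact_mod_cast hlt.le
    rw [sub_nonpos, le_div_iff₀ hm]
    nlinarith
  · have hc : (0 : ℝ) < m.choose d := by exact_mod_cast Nat.choose_pos (hdD.trans hDm)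
    have hc' : (0 : ℝ) < (m - 1).choose (d - 1) := by
      exact_mod_cast Nat.choose_pos (by omega)
    have h1 : (1 - D * (T.card + D) / m : ℝ) * ((m - 1).choose (d - 1) : ℝ)
        ≤ ((m - T.card).choose (d - 1) : ℝ) := by
      have hf : (0 : ℝ) < (d - 1).factorial := by exact_mod_cast Nat.factorial_pos _
      have hA : ((m - 1).choose (d - 1) : ℝ) ≤ (m : ℝ) ^ (d - 1) / (d - 1).factorial := by
        refine (Nat.choose_le_pow_div (d - 1) (m - 1)).trans ?_
        gcongr
        exact_mod_cast Nat.sub_le m 1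
      have hB : ((m : ℝ) - T.card - D) ^ (d - 1) / (d - 1).factorial
          ≤ ((m - T.card).choose (d - 1) : ℝ) := by
        refine le_trans ?_ (Nat.pow_le_choose (d - 1) (m - T.card))
        have h0 : (m : ℝ) - T.card - D = ((m - T.card - D : ℕ) : ℝ) := by
          rw [Nat.cast_sub (by omega), Nat.cast_sub (by omega)]
        rw [h0]
        have h' : ((m - T.card - D : ℕ) : ℝ) ≤ ((m - T.card + 1 - (d - 1) : ℕ) : ℝ) := by
          exact_mod_cast (by omega : m - T.card - D ≤ m - T.card + 1 - (d - 1))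
        exact div_le_div_of_nonneg_right (pow_le_pow_left₀ (Nat.cast_nonneg _) h' _) hf.le
      have hu : (T.card + D : ℝ) / m ≤ 1 := by
        rw [div_le_one hm]; exact_mod_cast hge
      have hC : (1 - D * (T.card + D) / m : ℝ) ≤ (1 - (T.card + D : ℝ) / m) ^ (d - 1) := by
        have hb := one_add_mul_le_pow (a := -((T.card + D : ℝ) / m)) (by linarith) (d - 1)
        have hu0 : 0 ≤ (T.card + D : ℝ) / m := by positivity
        have hdd : ((d - 1 : ℕ) : ℝ) ≤ D := by exact_mod_cast (by omega : d - 1 ≤ D)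
        have := mul_le_mul_of_nonneg_right hdd hu0
        rw [← sub_eq_add_neg] at hb
        rw [mul_div_assoc]
        linarith
      calc (1 - D * (T.card + D) / m : ℝ) * ((m - 1).choose (d - 1) : ℝ)
          ≤ (1 - (T.card + D : ℝ) / m) ^ (d - 1) * ((m - 1).choose (d - 1) : ℝ) := by gcongr
        _ ≤ (1 - (T.card + D : ℝ) / m) ^ (d - 1) * ((m : ℝ) ^ (d - 1) / (d - 1).factorial) := by
            have : 0 ≤ (1 - (T.card + D : ℝ) / m) ^ (d - 1) := pow_nonneg (by linarith) _
            gcongr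
        _ = ((m : ℝ) - T.card - D) ^ (d - 1) / (d - 1).factorial := by
            rw [← mul_div_assoc, ← mul_pow]
            congr 2
            field_simp
            ring
        _ ≤ _ := hB
    have h2 : ((T.card : ℝ) * ((m - T.card).choose (d - 1) : ℝ)) / m.choose d
        ≤ oddFraction T d := by
      unfold oddFraction
      gcongr
      exact_mod_cast card_mul_choose_le_card_odd T hd
    refine le_trans ?_ h2
    rw [le_div_iff₀ hc]
    have h3 := mul_choose_pred hd (hdD.trans hDm)
    calc (d * T.card / m : ℝ) * (1 - D * (T.card + D) / m) * m.choose d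
        = (T.card / m : ℝ) * (1 - D * (T.card + D) / m) * (m.choose d * d) := by ring
      _ = T.card * ((1 - D * (T.card + D) / m) * ((m - 1).choose (d - 1) : ℝ)) := by
          rw [← h3]; field_simp
      _ ≤ _ := by gcongr

/-- For odd `d`, every `d`-element subset of `T` meets `T` in an odd number of points. -/
theorem pow_le_oddFraction (T : Finset (Fin m)) {d : ℕ} (hd : Odd d) (hdT : d ≤ T.card) :
    ((T.card - d : ℝ) / m) ^ d ≤ oddFraction T d := by
  have hTm : T.card ≤ m := by simpa using T.card_le_univ
  have hm : (0 : ℝ) < m := by exact_mod_cast (by have := hd.pos; omega : 0 < m)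
  have hc : (0 : ℝ) < m.choose d := by exact_mod_cast Nat.choose_pos (hdT.trans hTm)
  have hle : T.card.choose d ≤
      ((Finset.univ.powersetCard d).filter fun S => Odd (S ∩ T).card).card := by
    rw [← Finset.card_powersetCard]
    refine Finset.card_le_card fun S hS => ?_
    rw [Finset.mem_powersetCard] at hS
    simp [Finset.inter_eq_left.mpr hS.1, hS.2, hd]
  have hf : (0 : ℝ) < d.factorial := by exact_mod_cast Nat.factorial_pos _
  have h1 : (T.card - d : ℝ) ^ d / d.factorial ≤ T.card.choose d := by
    refine le_trans ?_ (Nat.pow_le_choose d T.card)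
    rw [← Nat.cast_sub hdT]
    gcongr
    omega
  have h2 := Nat.choose_le_pow_div (α := ℝ) d m
  unfold oddFraction
  rw [le_div_iff₀ hc]
  have h0 : (0 : ℝ) ≤ T.card - d := by
    rw [sub_nonneg]; exact_mod_cast hdT
  calc ((T.card - d : ℝ) / m) ^ d * m.choose d
      ≤ ((T.card - d : ℝ) / m) ^ d * ((m : ℝ) ^ d / d.factorial) := by gcongr
    _ = (T.card - d : ℝ) ^ d / d.factorial := by
        rw [div_pow]; field_simp
    _ ≤ T.card.choose d := h1
    _ ≤ _ := by exact_mod_cast hle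

/-! ### Geometric means of likelihoods -/

/-- The weighted geometric mean `a ^ (1/2 - s) * b ^ (1/2 + s)`; for `s = 0` it is the summand of
the Bhattacharyya coefficient. -/
noncomputable def tilt (s a b : ℝ) : ℝ := a ^ (1 / 2 - s) * b ^ (1 / 2 + s)

theorem tilt_nonneg {s a b : ℝ} (ha : 0 ≤ a) (hb : 0 ≤ b) : 0 ≤ tilt s a b := by
  unfold tilt; positivity

theorem tilt_self {s a : ℝ} (ha : 0 < a) : tilt s a a = a := by
  rw [tilt, ← Real.rpow_add ha]
  norm_num

theorem tilt_zero_eq_sqrt {a b : ℝ} (ha : 0 ≤ a) : tilt 0 a b = √(a * b) := by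
  rw [tilt, Real.sqrt_mul ha, Real.sqrt_eq_rpow, Real.sqrt_eq_rpow]
  norm_num

theorem tilt_mul {s a b c e : ℝ} (ha : 0 ≤ a) (hb : 0 ≤ b) (hc : 0 ≤ c) (he : 0 ≤ e) :
    tilt s (a * b) (c * e) = tilt s a c * tilt s b e := by
  rw [tilt, tilt, tilt, Real.mul_rpow ha hb, Real.mul_rpow hc he]
  ring

theorem tilt_prod {ι : Type*} (t : Finset ι) (s : ℝ) (f g : ι → ℝ) (hf : ∀ i, 0 ≤ f i)
    (hg : ∀ i, 0 ≤ g i) : tilt s (∏ i ∈ t, f i) (∏ i ∈ t, g i) = ∏ i ∈ t, tilt s (f i) (g i) := by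
  unfold tilt
  rw [Finset.prod_mul_distrib, Real.finsetProd_rpow _ _ fun i _ => hf i,
    Real.finsetProd_rpow _ _ fun i _ => hg i]

theorem tilt_zero_zero {s : ℝ} (hs0 : 0 ≤ s) : tilt s 0 0 = 0 := by
  rw [tilt, Real.zero_rpow (x := 1 / 2 + s) (by linarith), mul_zero]

/-- The sum over the two answers of the geometric means of the probabilities of the answer under
two ground truths that disagree on the query. -/
noncomputable def noiseTilt (s e : ℝ) : ℝ := tilt s (1 - e) e + tilt s e (1 - e)

/-- The average over the workers of the decrease of the geometric mean that a distinguishing query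
of degree `d` causes. -/
noncomputable def gap {w : ℕ} (s : ℝ) (ε : Fin w → ℕ → ℝ) (d : ℕ) : ℝ :=
  (1 / (w : ℝ)) * ∑ k, (1 - noiseTilt s (ε k d))

theorem one_sub_noiseTilt_zero {e : ℝ} (h0 : 0 ≤ e) (h1 : e ≤ 1) :
    1 - noiseTilt 0 e = (√(1 - e) - √e) ^ 2 := by
  have h2 : 0 ≤ 1 - e := by linarith
  rw [noiseTilt, tilt_zero_eq_sqrt h2, tilt_zero_eq_sqrt h0, mul_comm e, Real.sqrt_mul h2, sub_sq,
    Real.sq_sqrt h2, Real.sq_sqrt h0]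
  ring

/-- The tilted geometric mean is `2 √(e (1 - e)) cosh (s log ((1 - e) / e))`, which differs from its
value at `s = 0` only in second order. -/
theorem noiseTilt_le {s e lam : ℝ} (hs : 0 ≤ s) (hl : 0 < lam) (h0 : lam ≤ e) (h1 : e ≤ 1 / 2 - lam)
    (hsl : s * Real.log (1 / lam) ≤ 1) :
    noiseTilt s e ≤ noiseTilt 0 e + (s * Real.log (1 / lam)) ^ 2 := by
  have he : 0 < e := by linarith
  have he1 : 0 < 1 - e := by linarith
  set u := s * (Real.log (1 - e) - Real.log e) with hu
  have hkey : noiseTilt s e = noiseTilt 0 e * Real.cosh u := by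
    simp only [noiseTilt, tilt, Real.rpow_def_of_pos he, Real.rpow_def_of_pos he1, ← Real.exp_add,
      Real.cosh_eq, hu]
    ring_nf
    simp only [← Real.exp_add]
    ring_nf
  have hu0 : 0 ≤ u := by
    have := Real.log_le_log he (by linarith : e ≤ 1 - e)
    exact mul_nonneg hs (by linarith)
  have hu1 : u ≤ s * Real.log (1 / lam) := by
    have h2 : Real.log (1 - e) ≤ 0 := Real.log_nonpos he1.le (by linarith)
    have h3 := Real.log_le_log hl h0
    rw [one_div, Real.log_inv]
    exact mul_le_mul_of_nonneg_left (by linarith) hs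
  have hle : noiseTilt 0 e ≤ 1 := by
    have := one_sub_noiseTilt_zero he.le (by linarith)
    nlinarith [sq_nonneg (√(1 - e) - √e)]
  have hge : 0 ≤ noiseTilt 0 e := add_nonneg (tilt_nonneg he1.le he.le) (tilt_nonneg he.le he1.le)
  have hcosh : Real.cosh u - 1 ≤ u ^ 2 := by
    have h2 := Real.cosh_le_exp_half_sq u
    have h3 : |u ^ 2 / 2| ≤ 1 := by
      rw [abs_of_nonneg (by positivity)]
      nlinarith
    have h4 := (abs_le.mp (Real.abs_exp_sub_one_le h3)).2
    rw [abs_of_nonneg (by positivity)] at h4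
    linarith
  have h5 : u ^ 2 ≤ (s * Real.log (1 / lam)) ^ 2 := pow_le_pow_left₀ hu0 hu1 2
  have h6 := Real.one_le_cosh u
  rw [hkey]
  nlinarith

/-! ### One query -/

variable {w n D : ℕ} {Φ : ℕ → ℝ} {ε : Fin w → ℕ → ℝ} {lam : ℝ}

/-- The labels on which two label vectors differ. -/
def diffSet (x v : Labels m) : Finset (Fin m) := Finset.univ.filter fun i => x i ≠ v i

theorem xorAnswer_mul (x v : Labels m) (S : Finset (Fin m)) :
    xorAnswer x S * xorAnswer v S = (-1) ^ (S ∩ diffSet x v).card := by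
  rw [xorAnswer, xorAnswer, ← Finset.prod_mul_distrib, ← Finset.prod_const,
    ← Finset.prod_ite_mem]
  refine Finset.prod_congr rfl fun i _ => ?_
  simp only [diffSet, Finset.mem_filter, Finset.mem_univ, true_and]
  rcases Int.units_eq_one_or (x i) with h | h <;> rcases Int.units_eq_one_or (v i) with h' | h' <;>
    simp [h, h']

theorem xorAnswer_eq_iff (x v : Labels m) (S : Finset (Fin m)) :
    xorAnswer x S = xorAnswer v S ↔ ¬ Odd (S ∩ diffSet x v).card := by
  have h : xorAnswer x S = xorAnswer v S ↔ xorAnswer x S * xorAnswer v S = 1 := by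
    rw [mul_eq_one_iff_eq_inv, Int.units_inv_eq_self]
  rw [h, xorAnswer_mul]
  rcases Nat.even_or_odd (S ∩ diffSet x v).card with h' | h'
  · simp [h'.neg_one_pow, h']
  · simp [h'.neg_one_pow, h']

theorem sum_tilt_answerProb {s e : ℝ} (h0 : 0 < e) (h1 : e < 1) (c c' : ℤˣ) :
    ∑ y, tilt s (answerProb e c y) (answerProb e c' y) = if c = c' then 1 else noiseTilt s e := by
  have hu : (Finset.univ : Finset ℤˣ) = {1, -1} := rfl
  rw [hu, Finset.sum_pair (by decide)]
  rcases Int.units_eq_one_or c with h | h <;> rcases Int.units_eq_one_or c' with h' | h' <;>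
    subst h <;> subst h' <;>
    simp [answerProb, tilt_self h0, tilt_self (sub_pos.mpr h1), noiseTilt, add_comm]

/-- Admissible parameters: a probability distribution `Φ` on the degrees `1, …, D`, at least one
worker, and error probabilities between `lam` and `1/2 - lam`. -/
structure Admissible (D : ℕ) (Φ : ℕ → ℝ) (w : ℕ) (ε : Fin w → ℕ → ℝ) (lam : ℝ) : Prop where
  nonneg : ∀ d ∈ Finset.Icc 1 D, 0 ≤ Φ d
  sum_eq : ∑ d ∈ Finset.Icc 1 D, Φ d = 1
  pos_workers : 0 < w
  pos_lam : 0 < lam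
  bounds : ∀ k, ∀ d ∈ Finset.Icc 1 D, lam ≤ ε k d ∧ ε k d ≤ 1 / 2 - lam

theorem queryProb_nonneg (h : Admissible D Φ w ε lam) (S : Finset (Fin m)) :
    0 ≤ queryProb D Φ S := by
  unfold queryProb
  split_ifs with hS
  · exact div_nonneg (h.nonneg _ hS) (Nat.cast_nonneg _)
  · exact le_rfl

theorem obsProb_nonneg (h : Admissible D Φ w ε lam) (x : Labels m) (q : Obs m w) :
    0 ≤ obsProb D Φ ε x q := by
  unfold obsProb
  by_cases hS : q.1.card ∈ Finset.Icc 1 D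
  · have h1 := h.bounds q.2.1 _ hS
    have h2 := h.pos_lam
    have h3 := queryProb_nonneg h q.1
    have : 0 ≤ answerProb (ε q.2.1 q.1.card) (xorAnswer x q.1) q.2.2 := by
      unfold answerProb
      split_ifs <;> linarith
    positivity
  · simp [queryProb, hS]

theorem likelihood_nonneg (h : Admissible D Φ w ε lam) (x : Labels m) (z : Data m w n) :
    0 ≤ likelihood D Φ ε x z :=
  Finset.prod_nonneg fun _ _ => obsProb_nonneg h x _

theorem sum_queryProb_mul (F : Finset (Fin m) → ℝ) :
    ∑ S, queryProb D Φ S * F S =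
      ∑ d ∈ Finset.Icc 1 D, Φ d / m.choose d * ∑ S ∈ Finset.univ.powersetCard d, F S := by
  have h1 : ∑ S, queryProb D Φ S * F S =
      ∑ S ∈ Finset.univ.filter (fun S : Finset (Fin m) => S.card ∈ Finset.Icc 1 D),
        Φ S.card / m.choose S.card * F S := by
    rw [Finset.sum_filter]
    refine Finset.sum_congr rfl fun S _ => ?_
    unfold queryProb
    split_ifs <;> simp
  rw [h1, ← Finset.sum_fiberwise_of_maps_to (g := Finset.card) (t := Finset.Icc 1 D)
    (fun S hS => (Finset.mem_filter.mp hS).2)]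
  refine Finset.sum_congr rfl fun d hd => ?_
  rw [Finset.mul_sum]
  refine Finset.sum_congr ?_ fun S hS => ?_
  · ext S
    simp only [Finset.mem_filter, Finset.mem_univ, true_and, Finset.mem_powersetCard,
      Finset.subset_univ]
    exact ⟨fun h => h.2, fun h => ⟨h ▸ hd, h⟩⟩
  · rw [(Finset.mem_powersetCard.mp hS).2]

/-- The Chernoff coefficient of the distributions of one observation under two ground truths; for
`s = 0` it is their Bhattacharyya coefficient. -/
noncomputable def chernoffSum (D : ℕ) (Φ : ℕ → ℝ) (ε : Fin w → ℕ → ℝ) (s : ℝ) (x v : Labels m) :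
    ℝ :=
  ∑ q : Obs m w, tilt s (obsProb D Φ ε x q) (obsProb D Φ ε v q)

theorem chernoffSum_nonneg (h : Admissible D Φ w ε lam) (s : ℝ) (x v : Labels m) :
    0 ≤ chernoffSum D Φ ε s x v :=
  Finset.sum_nonneg fun _ _ => tilt_nonneg (obsProb_nonneg h _ _) (obsProb_nonneg h _ _)

/-- Independence of the queries makes the Chernoff coefficient of the data a power. -/
theorem sum_tilt_likelihood (h : Admissible D Φ w ε lam) (s : ℝ) (x v : Labels m) :
    ∑ z : Data m w n, tilt s (likelihood D Φ ε x z) (likelihood D Φ ε v z) =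
      chernoffSum D Φ ε s x v ^ n := by
  rw [chernoffSum, Fintype.sum_pow]
  refine Finset.sum_congr rfl fun z _ => ?_
  exact tilt_prod _ _ _ _ (fun _ => obsProb_nonneg h _ _) (fun _ => obsProb_nonneg h _ _)

theorem chernoffSum_eq (h : Admissible D Φ w ε lam) (hDm : D ≤ m) {s : ℝ} (hs : 0 ≤ s)
    (x v : Labels m) :
    chernoffSum D Φ ε s x v =
      1 - ∑ d ∈ Finset.Icc 1 D, Φ d * gap s ε d * oddFraction (diffSet x v) d := by
  have hw : (w : ℝ) ≠ 0 := by exact_mod_cast h.pos_workers.ne'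
  have h1 : chernoffSum D Φ ε s x v = ∑ S : Finset (Fin m), queryProb D Φ S *
      (1 - if Odd (S ∩ diffSet x v).card then gap s ε S.card else 0) := by
    unfold chernoffSum
    rw [Fintype.sum_prod_type]
    refine Finset.sum_congr rfl fun S _ => ?_
    rw [Fintype.sum_prod_type]
    by_cases hS : S.card ∈ Finset.Icc 1 D
    · have hk : ∀ k : Fin w, ∑ y, tilt s (obsProb D Φ ε x (S, k, y)) (obsProb D Φ ε v (S, k, y)) =
          queryProb D Φ S * (1 / w) *
            (1 - if Odd (S ∩ diffSet x v).card then 1 - noiseTilt s (ε k S.card) else 0) := by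
        intro k
        have hb := h.bounds k _ hS
        have hl := h.pos_lam
        have hc : 0 ≤ queryProb D Φ S * (1 / (w : ℝ)) :=
          mul_nonneg (queryProb_nonneg h S) (by positivity)
        have ha : ∀ c y, 0 ≤ answerProb (ε k S.card) c y := by
          intro c y
          unfold answerProb
          split_ifs <;> linarith
        have hct : tilt s (queryProb D Φ S * (1 / (w : ℝ))) (queryProb D Φ S * (1 / (w : ℝ))) =
            queryProb D Φ S * (1 / (w : ℝ)) := by
          rcases hc.eq_or_lt with h' | h'
          · rw [← h', tilt_zero_zero hs]
          · exact tilt_self h'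
        simp only [obsProb, tilt_mul hc (ha _ _) hc (ha _ _), ← Finset.mul_sum, hct]
        rw [sum_tilt_answerProb (by linarith) (by linarith)]
        congr 1
        by_cases ho : Odd (S ∩ diffSet x v).card
        · rw [if_neg (fun h' => (xorAnswer_eq_iff x v S).mp h' ho), if_pos ho]
          ring
        · rw [if_pos ((xorAnswer_eq_iff x v S).mpr ho), if_neg ho]
          ring
      simp only [hk]
      rw [← Finset.mul_sum, mul_assoc]
      congr 1
      by_cases ho : Odd (S ∩ diffSet x v).card
      · simp only [if_pos ho, gap, Finset.sum_sub_distrib, Finset.sum_const, Finset.card_univ,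
          Fintype.card_fin, nsmul_eq_mul]
        field_simp
      · simp only [if_neg ho, sub_zero, Finset.sum_const, Finset.card_univ,
          Fintype.card_fin, nsmul_eq_mul]
        field_simp
    · simp [obsProb, queryProb, hS, tilt_zero_zero hs]
  rw [h1, sum_queryProb_mul]
  conv_rhs => rw [← h.sum_eq, ← Finset.sum_sub_distrib]
  refine Finset.sum_congr rfl fun d hd => ?_
  have hc : (m.choose d : ℝ) ≠ 0 := by
    exact_mod_cast (Nat.choose_pos ((Finset.mem_Icc.mp hd).2.trans hDm)).ne'
  have h2 : ∑ S ∈ Finset.univ.powersetCard d,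
      (1 - if Odd (S ∩ diffSet x v).card then gap s ε S.card else 0) =
      m.choose d - oddFraction (diffSet x v) d * m.choose d * gap s ε d := by
    rw [Finset.sum_sub_distrib, ← Finset.sum_filter, oddFraction, div_mul_cancel₀ _ hc]
    congr 1
    · simp
    · rw [← nsmul_eq_mul, ← Finset.sum_const]
      refine Finset.sum_congr rfl fun S hS => ?_
      rw [(Finset.mem_powersetCard.mp (Finset.mem_filter.mp hS).1).2]
  rw [h2]
  field_simp

/-! ### The exponent -/

/-- The denominator `∑_d d Φ_d (1/w) ∑_k (√(1 - ε_{k,d}) - √ε_{k,d})²` of the threshold. -/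
noncomputable def rate (D : ℕ) (Φ : ℕ → ℝ) (ε : Fin w → ℕ → ℝ) : ℝ :=
  ∑ d ∈ Finset.Icc 1 D, d * Φ d * gap 0 ε d

theorem threshold_eq (h : Admissible D Φ w ε lam) (m : ℕ) :
    threshold D Φ m ε = m * Real.log m / rate D Φ ε := by
  unfold threshold rate
  congr 1
  refine Finset.sum_congr rfl fun d hd => ?_
  rw [gap, Finset.mul_sum, Finset.mul_sum]
  refine Finset.sum_congr rfl fun k _ => ?_
  have hb := h.bounds k d hd
  have hl := h.pos_lam
  rw [one_sub_noiseTilt_zero (by linarith) (by linarith)]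
  ring

theorem gap_zero_mem (h : Admissible D Φ w ε lam) {d : ℕ} (hd : d ∈ Finset.Icc 1 D) :
    lam ^ 2 ≤ gap 0 ε d ∧ gap 0 ε d ≤ 1 := by
  have hw : (0 : ℝ) < w := by exact_mod_cast h.pos_workers
  have hk : ∀ k, lam ^ 2 ≤ 1 - noiseTilt 0 (ε k d) ∧ 1 - noiseTilt 0 (ε k d) ≤ 1 := by
    intro k
    have hb := h.bounds k d hd
    have hl := h.pos_lam
    constructor
    · rw [one_sub_noiseTilt_zero (by linarith) (by linarith)]
      refine pow_le_pow_left₀ hl.le ?_ 2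
      have h1 : √(1 - ε k d) ≤ 1 := Real.sqrt_le_one.mpr (by linarith)
      have h2 : √(ε k d) ≤ 1 := Real.sqrt_le_one.mpr (by linarith)
      have h3 := Real.sq_sqrt (by linarith : 0 ≤ 1 - ε k d)
      have h4 := Real.sq_sqrt (by linarith : 0 ≤ ε k d)
      have h5 : √(ε k d) ≤ √(1 - ε k d) := Real.sqrt_le_sqrt (by linarith)
      nlinarith [Real.sqrt_nonneg (ε k d)]
    · have : 0 ≤ noiseTilt 0 (ε k d) := add_nonneg (tilt_nonneg (by linarith) (by linarith))
        (tilt_nonneg (by linarith) (by linarith))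
      linarith
  rw [gap, one_div, inv_mul_eq_div, le_div_iff₀ hw, div_le_iff₀ hw]
  constructor
  · calc lam ^ 2 * w = ∑ _k : Fin w, lam ^ 2 := by simp [mul_comm]
      _ ≤ _ := Finset.sum_le_sum fun k _ => (hk k).1
  · calc _ ≤ ∑ _k : Fin w, (1 : ℝ) := Finset.sum_le_sum fun k _ => (hk k).2
      _ = 1 * w := by simp

theorem rate_mem (h : Admissible D Φ w ε lam) : lam ^ 2 ≤ rate D Φ ε ∧ rate D Φ ε ≤ D := by
  have hl := h.pos_lam
  constructor
  · calc lam ^ 2 = ∑ d ∈ Finset.Icc 1 D, Φ d * lam ^ 2 := by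
          rw [← Finset.sum_mul, h.sum_eq, one_mul]
      _ ≤ _ := by
          refine Finset.sum_le_sum fun d hd => ?_
          have h1 := h.nonneg d hd
          have h2 : (1 : ℝ) ≤ d := by exact_mod_cast (Finset.mem_Icc.mp hd).1
          exact mul_le_mul (by nlinarith) (gap_zero_mem h hd).1 (by positivity) (by positivity)
  · calc _ ≤ ∑ d ∈ Finset.Icc 1 D, D * Φ d := by
          refine Finset.sum_le_sum fun d hd => ?_
          have h1 := h.nonneg d hd
          have h2 : (d : ℝ) ≤ D := by exact_mod_cast (Finset.mem_Icc.mp hd).2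
          have h3 := gap_zero_mem h hd
          calc d * Φ d * gap 0 ε d ≤ d * Φ d * 1 := by gcongr; exact h3.2
            _ ≤ D * Φ d := by rw [mul_one]; gcongr
      _ = D := by rw [← Finset.mul_sum, h.sum_eq, mul_one]

theorem rate_pos (h : Admissible D Φ w ε lam) : 0 < rate D Φ ε :=
  lt_of_lt_of_le (pow_pos h.pos_lam 2) (rate_mem h).1

theorem one_le_degree (h : Admissible D Φ w ε lam) : 1 ≤ D := by
  by_contra hD
  have := h.sum_eq
  simp [show D = 0 by omega] at this

/-- Two label vectors that differ in a single label: here the coefficient is exact. -/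
theorem chernoffSum_of_diffSet_singleton (h : Admissible D Φ w ε lam) (hDm : D ≤ m)
    {x v : Labels m} {i : Fin m} (hxv : diffSet x v = {i}) :
    chernoffSum D Φ ε 0 x v = 1 - rate D Φ ε / m := by
  rw [chernoffSum_eq h hDm le_rfl, hxv, rate, Finset.sum_div]
  congr 1
  refine Finset.sum_congr rfl fun d hd => ?_
  have hd' := Finset.mem_Icc.mp hd
  rw [oddFraction_singleton i hd'.1 (hd'.2.trans hDm)]
  ring

/-- Tilting changes the Chernoff coefficient of two label vectors that differ in a single label only
in second order. -/
theorem chernoffSum_tilt_le (h : Admissible D Φ w ε lam) (hDm : D ≤ m) {x v : Labels m} {i : Fin m}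
    (hxv : diffSet x v = {i}) {s : ℝ} (hs : 0 ≤ s) (hsl : s * Real.log (1 / lam) ≤ 1) :
    chernoffSum D Φ ε s x v ≤ 1 - rate D Φ ε / m + D / m * (s * Real.log (1 / lam)) ^ 2 := by
  have hw : (0 : ℝ) < w := by exact_mod_cast h.pos_workers
  set c := (s * Real.log (1 / lam)) ^ 2
  have hgap : ∀ d ∈ Finset.Icc 1 D, gap 0 ε d - c ≤ gap s ε d := by
    intro d hd
    have h1 : ∑ k, ((1 - noiseTilt 0 (ε k d)) - c) ≤ ∑ k, (1 - noiseTilt s (ε k d)) := by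
      refine Finset.sum_le_sum fun k _ => ?_
      have hb := h.bounds k d hd
      have := noiseTilt_le hs h.pos_lam hb.1 hb.2 hsl
      linarith
    rw [Finset.sum_sub_distrib, Finset.sum_const, Finset.card_univ, Fintype.card_fin,
      nsmul_eq_mul] at h1
    have h2 : gap 0 ε d - c = 1 / (w : ℝ) * (∑ k, (1 - noiseTilt 0 (ε k d)) - w * c) := by
      rw [gap]; field_simp
    rw [h2, gap]
    gcongr
  rw [chernoffSum_eq h hDm hs, hxv, rate, Finset.sum_div]
  have : ∑ d ∈ Finset.Icc 1 D, (d * Φ d * gap 0 ε d / m - Φ d * (D / m * c)) ≤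
      ∑ d ∈ Finset.Icc 1 D, Φ d * gap s ε d * oddFraction {i} d := by
    refine Finset.sum_le_sum fun d hd => ?_
    have hd' := Finset.mem_Icc.mp hd
    rw [oddFraction_singleton i hd'.1 (hd'.2.trans hDm)]
    have h1 := hgap d hd
    have h2 := h.nonneg d hd
    have hdD : (d : ℝ) ≤ D := by exact_mod_cast hd'.2
    calc d * Φ d * gap 0 ε d / m - Φ d * (D / m * c)
        ≤ d * Φ d * gap 0 ε d / m - Φ d * (d / m * c) := by gcongr
      _ = Φ d * (gap 0 ε d - c) * (d / m) := by ring
      _ ≤ Φ d * gap s ε d * (d / m) := by gcongr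
  rw [Finset.sum_sub_distrib, ← Finset.sum_mul, h.sum_eq, one_mul] at this
  linarith

theorem chernoffSum_le (h : Admissible D Φ w ε lam) (hDm : D ≤ m) (x v : Labels m) :
    chernoffSum D Φ ε 0 x v ≤ 1 - (diffSet x v).card * rate D Φ ε / m *
      (1 - D * ((diffSet x v).card + D) / m) := by
  rw [chernoffSum_eq h hDm le_rfl, rate, Finset.mul_sum, Finset.sum_div, Finset.sum_mul]
  refine sub_le_sub_left (Finset.sum_le_sum fun d hd => ?_) 1
  have hd' := Finset.mem_Icc.mp hd
  have h1 := le_oddFraction (diffSet x v) hd'.1 hd'.2 hDm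
  have h2 := h.nonneg d hd
  have h3 := gap_zero_mem h hd
  have h4 : 0 ≤ Φ d * gap 0 ε d := mul_nonneg h2 ((sq_nonneg lam).trans h3.1)
  calc _ = Φ d * gap 0 ε d * ((d * (diffSet x v).card / m : ℝ) *
        (1 - D * ((diffSet x v).card + D) / m)) := by ring
    _ ≤ _ := mul_le_mul_of_nonneg_left h1 h4

/-- A query of odd degree keeps the coefficient of two label vectors that differ in many labels away
from `1`. -/
theorem chernoffSum_le_of_odd (h : Admissible D Φ w ε lam) (hDm : D ≤ m) (x v : Labels m) {d : ℕ}
    (hd : d ∈ Finset.Icc 1 D) (hodd : Odd d) (hdT : d ≤ (diffSet x v).card) :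
    chernoffSum D Φ ε 0 x v ≤ 1 - Φ d * lam ^ 2 * (((diffSet x v).card - d : ℝ) / m) ^ d := by
  rw [chernoffSum_eq h hDm le_rfl]
  refine sub_le_sub_left ?_ 1
  have h2 := h.nonneg d hd
  have h0 : (0 : ℝ) ≤ (diffSet x v).card - d := by rw [sub_nonneg]; exact_mod_cast hdT
  refine le_trans ?_ (Finset.single_le_sum
    (f := fun d => Φ d * gap 0 ε d * oddFraction (diffSet x v) d) (fun e he => ?_) hd)
  · have h1 := (gap_zero_mem h hd).1
    have h3 := pow_le_oddFraction (diffSet x v) hodd hdT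
    gcongr
    exact mul_nonneg h2 ((sq_nonneg lam).trans h1)
  · exact mul_nonneg (mul_nonneg (h.nonneg e he) ((sq_nonneg lam).trans (gap_zero_mem h he).1))
      (oddFraction_nonneg _ _)

/-! ### Optimality of maximum likelihood -/

theorem sum_errorProb (est : Data m w n → Labels m) :
    ∑ x, errorProb D Φ ε est x =
      ∑ z, (∑ x, likelihood D Φ ε x z - likelihood D Φ ε (est z) z) := by
  unfold errorProb
  rw [Finset.sum_comm]
  refine Finset.sum_congr rfl fun z _ => ?_
  rw [eq_sub_iff_add_eq, ← Finset.sum_erase_add _ _ (Finset.mem_univ (est z)),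
    ← Finset.sum_erase_add _ (fun x => likelihood D Φ ε x z) (Finset.mem_univ (est z))]
  simp only [ne_eq, not_true_eq_false, if_false, add_zero]
  congr 1
  refine Finset.sum_congr rfl fun x hx => ?_
  rw [if_pos (Finset.ne_of_mem_erase hx).symm]

theorem avgErrorProb_le_of_isML {ml : Data m w n → Labels m} (hml : IsML D Φ ε ml)
    (est : Data m w n → Labels m) : avgErrorProb D Φ ε ml ≤ avgErrorProb D Φ ε est := by
  unfold avgErrorProb
  rw [sum_errorProb, sum_errorProb]
  gcongr
  exact hml _ _

/-! ### Achievability -/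

theorem errorProb_nonneg (h : Admissible D Φ w ε lam) (est : Data m w n → Labels m)
    (x : Labels m) : 0 ≤ errorProb D Φ ε est x :=
  Finset.sum_nonneg fun z _ => by
    split_ifs
    exacts [likelihood_nonneg h x z, le_rfl]

/-- The union bound: a wrong `v` beats the ground truth `x` with probability at most the
Bhattacharyya coefficient of the data under `x` and `v`. -/
theorem errorProb_le_sum (h : Admissible D Φ w ε lam) {ml : Data m w n → Labels m}
    (hml : IsML D Φ ε ml) (x : Labels m) :
    errorProb D Φ ε ml x ≤ ∑ v ∈ Finset.univ.erase x, chernoffSum D Φ ε 0 x v ^ n := by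
  simp only [← sum_tilt_likelihood h]
  rw [Finset.sum_comm]
  unfold errorProb
  refine Finset.sum_le_sum fun z _ => ?_
  have hnn : ∀ v, 0 ≤ tilt 0 (likelihood D Φ ε x z) (likelihood D Φ ε v z) := fun v =>
    tilt_nonneg (likelihood_nonneg h x z) (likelihood_nonneg h v z)
  split_ifs with hz
  · refine le_trans ?_ (Finset.single_le_sum
      (f := fun v => tilt 0 (likelihood D Φ ε x z) (likelihood D Φ ε v z)) (fun v _ => hnn v)
      (Finset.mem_erase.mpr ⟨hz, Finset.mem_univ _⟩))
    have h0 := likelihood_nonneg h x z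
    rw [tilt_zero_eq_sqrt h0]
    refine Real.le_sqrt_of_sq_le ?_
    rw [sq]
    exact mul_le_mul_of_nonneg_left (hml z x) h0
  · exact Finset.sum_nonneg fun v _ => hnn v

theorem sum_pow_card_diffSet (x : Labels m) (r : ℝ) :
    ∑ v, r ^ (diffSet x v).card = (1 + r) ^ m := by
  have h1 : ∀ v : Labels m, r ^ (diffSet x v).card = ∏ i, if x i ≠ v i then r else 1 := by
    intro v
    rw [← Finset.prod_const, diffSet, Finset.prod_filter]
  have h2 : ∀ i, ∑ y : ℤˣ, (if x i ≠ y then r else 1) = 1 + r := by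
    intro i
    have hu : (Finset.univ : Finset ℤˣ) = {1, -1} := rfl
    rw [hu, Finset.sum_pair (by decide)]
    rcases Int.units_eq_one_or (x i) with h | h <;> simp [h, add_comm, units_ne_neg_self]
  have h3 := Finset.prod_univ_sum (fun _ : Fin m => (Finset.univ : Finset ℤˣ))
    (fun i y => if x i ≠ y then r else 1)
  simp only [h2, Finset.prod_const, Finset.card_univ, Fintype.card_fin,
    Fintype.piFinset_univ] at h3
  simp only [h1, h3]

theorem pow_le_exp_of_le_one_sub {b a : ℝ} (hb : 0 ≤ b) (h : b ≤ 1 - a) (n : ℕ) :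
    b ^ n ≤ Real.exp (-(n * a)) := by
  calc b ^ n ≤ Real.exp (-a) ^ n := pow_le_pow_left₀ hb (h.trans (Real.one_sub_le_exp_neg a)) n
    _ = _ := by rw [← Real.exp_nat_mul]; ring_nf

/-- The Bhattacharyya coefficient of the data for label vectors that differ in `t` labels: it is at
most `m ^ (-(1 + η / 2) t)` for `t ≤ δ m`, and negligible against `2 ^ (-m)` for larger `t`. -/
theorem chernoffSum_pow_le (h : Admissible D Φ w ε lam) {η δ : ℝ} (hη : 0 < η) (hδ : 0 < δ)
    (hδη : (1 + η) * (1 - 2 * D * δ) ≥ 1 + η / 2) {d : ℕ} (hd : d ∈ Finset.Icc 1 D) (hodd : Odd d)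
    (hDm : D ≤ m) (hm : 2 * D ≤ δ * m)
    (hlog : 2 * D ≤ Φ d * lam ^ 2 * (δ / 2) ^ d * Real.log m)
    (hn : (1 + η) * threshold D Φ m ε ≤ n) (x v : Labels m) :
    chernoffSum D Φ ε 0 x v ^ n ≤
      Real.exp (-((1 + η / 2) * Real.log m)) ^ (diffSet x v).card + Real.exp (-(2 * m)) := by
  have hD : 1 ≤ D := one_le_degree h
  have hD' : (1 : ℝ) ≤ D := by exact_mod_cast hD
  have hm1 : (1 : ℝ) ≤ m := by exact_mod_cast hD.trans hDm
  have hm0 : (0 : ℝ) < m := by linarith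
  have hL : 0 ≤ Real.log m := Real.log_nonneg hm1
  have hr := rate_pos h
  have hB := chernoffSum_nonneg h 0 x v
  rw [threshold_eq h] at hn
  have hdm := Finset.mem_Icc.mp hd
  set t := (diffSet x v).card
  rcases le_or_gt (t : ℝ) (δ * m) with ht | ht
  · refine le_trans ?_ (le_add_of_nonneg_right (Real.exp_pos _).le)
    have h1 := chernoffSum_le h hDm x v
    refine (pow_le_exp_of_le_one_sub hB h1 n).trans ?_
    rw [← Real.exp_nat_mul]
    refine Real.exp_le_exp.mpr ?_
    have h2 : 1 - 2 * D * δ ≤ 1 - D * (t + D : ℝ) / m := by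
      refine sub_le_sub_left ?_ 1
      rw [div_le_iff₀ hm0]
      nlinarith
    have h3 : 0 < 1 - 2 * D * δ := by
      by_contra hneg
      nlinarith
    have h4 : (t : ℝ) * ((1 + η / 2) * Real.log m) ≤
        n * (t * rate D Φ ε / m * (1 - D * (t + D : ℝ) / m)) := by
      calc (t : ℝ) * ((1 + η / 2) * Real.log m)
          ≤ t * (((1 + η) * (1 - 2 * D * δ)) * Real.log m) := by gcongr
        _ = ((1 + η) * (m * Real.log m / rate D Φ ε)) *
              (t * rate D Φ ε / m * (1 - 2 * D * δ)) := by field_simp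
        _ ≤ n * (t * rate D Φ ε / m * (1 - D * (t + D : ℝ) / m)) := by gcongr
    linarith
  · refine le_trans ?_ (le_add_of_nonneg_left (pow_nonneg (Real.exp_pos _).le _))
    have hdD : (d : ℝ) ≤ D := by exact_mod_cast hdm.2
    have hdt : d ≤ t := by
      have : (d : ℝ) ≤ t := by linarith
      exact_mod_cast this
    have h1 := chernoffSum_le_of_odd h hDm x v hd hodd hdt
    have hΦ := h.nonneg d hd
    set β := Φ d * lam ^ 2 * (δ / 2) ^ d
    have hβ : 0 ≤ β := by positivity
    have h2 : chernoffSum D Φ ε 0 x v ≤ 1 - β := by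
      refine h1.trans (sub_le_sub_left ?_ 1)
      have : δ / 2 ≤ (t - d : ℝ) / m := by
        rw [le_div_iff₀ hm0]
        linarith
      exact mul_le_mul_of_nonneg_left (pow_le_pow_left₀ (half_pos hδ).le this d)
        (mul_nonneg hΦ (sq_nonneg lam))
    refine (pow_le_exp_of_le_one_sub hB h2 n).trans (Real.exp_le_exp.mpr ?_)
    have h3 : m * Real.log m / D ≤ n := by
      calc m * Real.log m / D ≤ m * Real.log m / rate D Φ ε := by
            gcongr
            exact (rate_mem h).2
        _ ≤ (1 + η) * (m * Real.log m / rate D Φ ε) :=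
            le_mul_of_one_le_left (by positivity) (by linarith)
        _ ≤ n := hn
    have h4 : (2 * m : ℝ) ≤ n * β := by
      calc (2 * m : ℝ) = m / D * (2 * D) := by field_simp
        _ ≤ m / D * (β * Real.log m) := by gcongr
        _ = m * Real.log m / D * β := by ring
        _ ≤ n * β := by gcongr
    linarith

theorem errorProb_le (h : Admissible D Φ w ε lam) {η δ : ℝ} (hη : 0 < η) (hδ : 0 < δ)
    (hδη : (1 + η) * (1 - 2 * D * δ) ≥ 1 + η / 2) {d : ℕ} (hd : d ∈ Finset.Icc 1 D) (hodd : Odd d)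
    (hDm : D ≤ m) (hm : 2 * D ≤ δ * m)
    (hlog : 2 * D ≤ Φ d * lam ^ 2 * (δ / 2) ^ d * Real.log m)
    (hn : (1 + η) * threshold D Φ m ε ≤ n) {ml : Data m w n → Labels m}
    (hml : IsML D Φ ε ml) (x : Labels m) :
    errorProb D Φ ε ml x ≤
      Real.exp (Real.exp (-(η / 2 * Real.log m))) - 1 + Real.exp (-(m : ℝ)) := by
  have hm0 : (0 : ℝ) < m := by exact_mod_cast (one_le_degree h).trans hDm
  refine (errorProb_le_sum h hml x).trans ?_
  set r := Real.exp (-((1 + η / 2) * Real.log m)) with hr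
  have h1 : ∑ v ∈ Finset.univ.erase x, chernoffSum D Φ ε 0 x v ^ n ≤
      ∑ v ∈ Finset.univ.erase x, (r ^ (diffSet x v).card + Real.exp (-(2 * m))) :=
    Finset.sum_le_sum fun v _ => chernoffSum_pow_le h hη hδ hδη hd hodd hDm hm hlog hn x v
  refine h1.trans ?_
  rw [Finset.sum_add_distrib]
  refine add_le_add ?_ ?_
  · have h2 := Finset.sum_erase_add Finset.univ (fun v => r ^ (diffSet x v).card)
      (Finset.mem_univ x)
    have h3 : diffSet x x = ∅ := by simp [diffSet]
    rw [sum_pow_card_diffSet, h3, Finset.card_empty, pow_zero] at h2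
    have h4 : (1 + r) ^ m ≤ Real.exp (Real.exp (-(η / 2 * Real.log m))) := by
      calc (1 + r) ^ m ≤ Real.exp r ^ m := by
            have : 0 < r := Real.exp_pos _
            gcongr
            rw [add_comm]
            exact Real.add_one_le_exp r
        _ = Real.exp (Real.exp (-(η / 2 * Real.log m))) := by
            rw [← Real.exp_nat_mul]
            congr 1
            conv_lhs => rw [← Real.exp_log hm0, hr, ← Real.exp_add]
            ring_nf
    linarith
  · have hcard : ((Finset.univ.erase x).card : ℝ) ≤ Real.exp m := by
      calc ((Finset.univ.erase x).card : ℝ) ≤ (Fintype.card (Labels m) : ℝ) := by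
            exact_mod_cast Finset.card_le_univ _
        _ = 2 ^ m := by simp
        _ ≤ Real.exp 1 ^ m := by
            gcongr
            linarith [Real.add_one_le_exp (1 : ℝ)]
        _ = Real.exp m := by rw [← Real.exp_nat_mul, mul_one]
    rw [Finset.sum_const, nsmul_eq_mul]
    calc _ ≤ Real.exp m * Real.exp (-(2 * m)) := by gcongr
      _ = Real.exp (-(m : ℝ)) := by rw [← Real.exp_add]; ring_nf

theorem tendsto_log_natCast : Tendsto (fun m : ℕ => Real.log m) atTop atTop :=
  Real.tendsto_log_atTop.comp tendsto_natCast_atTop_atTop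

theorem tendsto_iSup_errorProb {w : ℕ → ℕ} {ε : ∀ m, Fin (w m) → ℕ → ℝ}
    (h : ∀ m, Admissible D Φ (w m) (ε m) lam)
    (hodd : 0 < ∑ d ∈ (Finset.Icc 1 D).filter (fun d => Odd d), Φ d) {η : ℝ} (hη : 0 < η)
    {n : ℕ → ℕ} {ml : ∀ m, Data m (w m) (n m) → Labels m} (hml : ∀ m, IsML D Φ (ε m) (ml m))
    (hn : ∀ᶠ m in atTop, (1 + η) * threshold D Φ m (ε m) ≤ (n m : ℝ)) :
    Tendsto (fun m => ⨆ x, errorProb D Φ (ε m) (ml m) x) atTop (𝓝 0) := by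
  obtain ⟨d, hd, hd0⟩ := Finset.exists_ne_zero_of_sum_ne_zero hodd.ne'
  rw [Finset.mem_filter] at hd
  have hΦd : 0 < Φ d := lt_of_le_of_ne ((h 0).nonneg d hd.1) hd0.symm
  have hD : (0 : ℝ) < D := by exact_mod_cast one_le_degree (h 0)
  have hl := (h 0).pos_lam
  set δ := η / (4 * D * (1 + η)) with hδ'
  have hδ : 0 < δ := by positivity
  have hδη : (1 + η) * (1 - 2 * D * δ) ≥ 1 + η / 2 := by
    have : (1 + η) * (1 - 2 * D * δ) = 1 + η / 2 := by
      rw [hδ']; field_simp; ring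
    exact this.ge
  have hlog := tendsto_log_natCast
  have hlim : Tendsto (fun m : ℕ => Real.exp (Real.exp (-(η / 2 * Real.log m))) - 1 +
      Real.exp (-(m : ℝ))) atTop (𝓝 0) := by
    have h1 : Tendsto (fun m : ℕ => Real.exp (-(η / 2 * Real.log m))) atTop (𝓝 0) :=
      Real.tendsto_exp_neg_atTop_nhds_zero.comp (hlog.const_mul_atTop (half_pos hη))
    have h2 : Tendsto (fun m : ℕ => Real.exp (-(m : ℝ))) atTop (𝓝 0) :=
      Real.tendsto_exp_neg_atTop_nhds_zero.comp tendsto_natCast_atTop_atTop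
    have h3 := (((Real.continuous_exp.tendsto 0).comp h1).sub_const 1).add h2
    simpa using h3
  have hβ : 0 < Φ d * lam ^ 2 * (δ / 2) ^ d := by positivity
  refine tendsto_of_tendsto_of_tendsto_of_le_of_le' tendsto_const_nhds hlim
    (Eventually.of_forall fun m => Real.iSup_nonneg fun x => errorProb_nonneg (h m) _ x) ?_
  filter_upwards [hn, eventually_ge_atTop D,
    (tendsto_natCast_atTop_atTop.const_mul_atTop hδ).eventually_ge_atTop (2 * D : ℝ),
    (hlog.const_mul_atTop hβ).eventually_ge_atTop (2 * D : ℝ)] with m h1 h2 h3 h4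
  exact ciSup_le fun x => errorProb_le (h m) hη hδ hδη hd.1 hd.2 h2 h3 h4 h1 (hml m) x

/-! ### A truncated second moment bound -/

section SecondMoment

variable {Ω ι : Type*} [Fintype Ω] [Fintype ι]

/-- The square root of the likelihood ratio `q / p`, set to `0` unless the ratio lies between
`M⁻¹` and `M`. -/
noncomputable def truncRatio (M p q : ℝ) : ℝ := if q ≤ M * p ∧ p ≤ M * q then √(q / p) else 0

theorem truncRatio_nonneg (M p q : ℝ) : 0 ≤ truncRatio M p q := by
  unfold truncRatio
  split_ifs
  exacts [Real.sqrt_nonneg _, le_rfl]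

theorem mul_sqrt_div {p q : ℝ} (hp : 0 ≤ p) : p * √(q / p) = √(p * q) := by
  rcases hp.eq_or_lt with rfl | hp'
  · simp
  · have : p * q = p ^ 2 * (q / p) := by field_simp
    rw [this, Real.sqrt_mul (sq_nonneg p), Real.sqrt_sq hp]

theorem sub_le_mul_truncRatio {M p q : ℝ} (hp : 0 ≤ p) :
    √(p * q) - (if M * p < q then √(p * q) else 0) - (if M * q < p then √(q * p) else 0) ≤
      p * truncRatio M p q := by
  have h0 := Real.sqrt_nonneg (p * q)
  have h1 := Real.sqrt_nonneg (q * p)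
  rw [mul_comm q p] at h1 ⊢
  unfold truncRatio
  by_cases h : q ≤ M * p <;> by_cases h' : p ≤ M * q
  · rw [if_neg h.not_gt, if_neg h'.not_gt, if_pos ⟨h, h'⟩, mul_sqrt_div hp]
    linarith
  · rw [if_neg h.not_gt, if_pos (not_le.mp h'), if_neg (fun hh => h' hh.2)]
    linarith
  · rw [if_pos (not_le.mp h), if_neg h'.not_gt, if_neg (fun hh => h hh.1)]
    linarith
  · rw [if_pos (not_le.mp h), if_pos (not_le.mp h'), if_neg (fun hh => h hh.1)]
    linarith

theorem mul_truncRatio_le {M p q : ℝ} (hp : 0 ≤ p) : p * truncRatio M p q ≤ √(p * q) := by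
  unfold truncRatio
  split_ifs
  · exact (mul_sqrt_div hp).le
  · rw [mul_zero]; exact Real.sqrt_nonneg _

theorem truncRatio_le {M p q : ℝ} (hM : 0 ≤ M) (hp : 0 ≤ p) : truncRatio M p q ≤ √M := by
  unfold truncRatio
  split_ifs with h
  · refine Real.sqrt_le_sqrt ?_
    rcases hp.eq_or_lt with rfl | hp'
    · simpa using hM
    · rw [div_le_iff₀ hp']; exact h.1
  · exact Real.sqrt_nonneg _

theorem mul_truncRatio_mul_truncRatio_le {M p q r : ℝ} (hp : 0 ≤ p) (hq : 0 ≤ q) :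
    p * truncRatio M p q * truncRatio M p r ≤ √(q * r) := by
  rcases hp.eq_or_lt with rfl | hp'
  · simp
  · have h1 : truncRatio M p q ≤ √(q / p) := by
      unfold truncRatio; split_ifs; exacts [le_rfl, Real.sqrt_nonneg _]
    have h2 : truncRatio M p r ≤ √(r / p) := by
      unfold truncRatio; split_ifs; exacts [le_rfl, Real.sqrt_nonneg _]
    have h3 := truncRatio_nonneg M p q
    have h4 := truncRatio_nonneg M p r
    calc p * truncRatio M p q * truncRatio M p r ≤ p * √(q / p) * √(r / p) := by gcongr
      _ = √(q * r) := by
        rw [mul_assoc, ← Real.sqrt_mul (by positivity)]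
        have : q / p * (r / p) = q * r / p ^ 2 := by field_simp
        rw [this, Real.sqrt_div' _ (sq_nonneg p), Real.sqrt_sq hp]
        field_simp

theorem mul_truncRatio_le_sqrt_mul {M p q : ℝ} (hM : 0 ≤ M) (hp : 0 ≤ p) (hq : 0 ≤ q) :
    p * truncRatio M p q ≤ √M * q := by
  unfold truncRatio
  split_ifs with h
  · rw [mul_sqrt_div hp]
    calc √(p * q) ≤ √(M * q * q) := Real.sqrt_le_sqrt (by gcongr; exact h.2)
      _ = √M * q := by rw [mul_assoc, Real.sqrt_mul hM, Real.sqrt_mul_self hq]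
  · rw [mul_zero]; positivity

/-- Let `b` be the common Bhattacharyya coefficient of `P` and each of the `Q i`. If the `Q i` are
pairwise nearly uncorrelated in the sense of `hoff`, and the contribution of likelihood ratios
outside `[M⁻¹, M]` to the coefficients is small, then `∑ i, Q i` is at least a large multiple of `P`
outside a set of small `P`-measure. This is Chebyshev's inequality for the sum of the truncated
square roots of the likelihood ratios. Without the square roots, the mean would be dominated by rare
large values; without the truncation, the second moment would be too large. -/
theorem sum_lt_of_secondMoment (P : Ω → ℝ) (Q : ι → Ω → ℝ) (hP : ∀ z, 0 ≤ P z)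
    (hQ : ∀ i z, 0 ≤ Q i z) (hP1 : ∑ z, P z = 1) {M b δ : ℝ} (hM : 0 < M) (hb : 0 < b)
    (hN : 0 < Fintype.card ι)
    (hbhatt : ∀ i, ∑ z, √(P z * Q i z) = b)
    (hoff : ∀ i j, i ≠ j → ∑ z, √(Q i z * Q j z) ≤ (1 + δ) * b ^ 2) (hδ : 0 ≤ δ)
    (hup : ∀ i, ∑ z, (if M * P z < Q i z then √(P z * Q i z) else 0) ≤ δ * b)
    (hlo : ∀ i, ∑ z, (if M * Q i z < P z then √(Q i z * P z) else 0) ≤ δ * b)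
    (hMb : √M ≤ δ * (Fintype.card ι * b)) :
    ∑ z, (if ∑ i, Q i z < Fintype.card ι * b / (2 * √M) * P z then P z else 0) ≤ 24 * δ := by
  classical
  set N : ℝ := ((Fintype.card ι : ℕ) : ℝ) with hNdef
  have hN0 : 0 < N := by rw [hNdef]; exact_mod_cast hN
  set f : ι → Ω → ℝ := fun i z => truncRatio M (P z) (Q i z) with hf
  have hmean : ∀ i, (1 - 2 * δ) * b ≤ ∑ z, P z * f i z := by
    intro i
    have h1 := Finset.sum_le_sum fun z (_ : z ∈ Finset.univ) =>
      sub_le_mul_truncRatio (M := M) (q := Q i z) (hP z)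
    rw [Finset.sum_sub_distrib, Finset.sum_sub_distrib, hbhatt i] at h1
    have h2 := hup i
    have h3 := hlo i
    simp only [hf]
    linarith
  have hsecond : ∀ i j, ∑ z, P z * f i z * f j z ≤
      (if i = j then √M * b else 0) + (1 + δ) * b ^ 2 := by
    intro i j
    split_ifs with hij
    · subst hij
      have h1 : ∑ z, P z * f i z * f i z ≤ √M * b := by
        rw [← hbhatt i, Finset.mul_sum]
        refine Finset.sum_le_sum fun z _ => ?_
        rw [mul_comm]
        exact mul_le_mul (truncRatio_le hM.le (hP z)) (mul_truncRatio_le (hP z))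
          (mul_nonneg (hP z) (truncRatio_nonneg _ _ _)) (Real.sqrt_nonneg _)
      have : 0 ≤ (1 + δ) * b ^ 2 := by positivity
      linarith
    · rw [zero_add]
      refine le_trans (Finset.sum_le_sum fun z _ => ?_) (hoff i j hij)
      exact mul_truncRatio_mul_truncRatio_le (hP z) (hQ i z)
  have hvar : ∑ z, P z * (∑ i, f i z - N * b) ^ 2 ≤ 6 * δ * (N * b) ^ 2 := by
    have h1 : ∑ z, P z * (∑ i, f i z - N * b) ^ 2 =
        ∑ i, ∑ j, ∑ z, P z * f i z * f j z - 2 * (N * b) * ∑ i, ∑ z, P z * f i z + (N * b) ^ 2 := by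
      have h2 : ∀ z, P z * (∑ i, f i z - N * b) ^ 2 = ∑ i, ∑ j, P z * f i z * f j z -
          2 * (N * b) * ∑ i, P z * f i z + (N * b) ^ 2 * P z := by
        intro z
        simp only [← Finset.mul_sum, ← Finset.sum_mul]
        ring
      simp only [h2]
      rw [Finset.sum_add_distrib, Finset.sum_sub_distrib, ← Finset.mul_sum, ← Finset.mul_sum, hP1,
        mul_one]
      congr 2
      · exact Finset.sum_comm.trans (Finset.sum_congr rfl fun i _ => Finset.sum_comm)
      · rw [Finset.sum_comm]
    have h3 : ∑ i, ∑ j, ∑ z, P z * f i z * f j z ≤ N * (√M * b) + N * (N * ((1 + δ) * b ^ 2)) := by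
      refine (Finset.sum_le_sum fun i _ => Finset.sum_le_sum fun j _ => hsecond i j).trans ?_
      simp [Finset.sum_add_distrib, hNdef]
    have h4 : N * ((1 - 2 * δ) * b) ≤ ∑ i, ∑ z, P z * f i z := by
      refine le_trans ?_ (Finset.sum_le_sum fun i _ => hmean i)
      simp [hNdef]
    have h5 : N * (√M * b) ≤ δ * (N * b) ^ 2 := by
      calc N * (√M * b) = √M * (N * b) := by ring
        _ ≤ δ * (N * b) * (N * b) := by gcongr
        _ = _ := by ring
    have h6 : 2 * (N * b) * (N * ((1 - 2 * δ) * b)) ≤ 2 * (N * b) * ∑ i, ∑ z, P z * f i z := by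
      gcongr
    rw [h1]
    nlinarith
  have hNb : 0 < N * b := mul_pos hN0 hb
  have hMs : 0 < √M := Real.sqrt_pos.mpr hM
  have hpt : ∀ z, (if ∑ i, Q i z < N * b / (2 * √M) * P z then P z else 0) ≤
      4 / (N * b) ^ 2 * (P z * (∑ i, f i z - N * b) ^ 2) := by
    intro z
    split_ifs with hz
    · have h1 : ∑ i, P z * f i z ≤ √M * ∑ i, Q i z := by
        rw [Finset.mul_sum]
        exact Finset.sum_le_sum fun i _ => mul_truncRatio_le_sqrt_mul hM.le (hP z) (hQ i z)
      rw [← Finset.mul_sum] at h1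
      have h2 : P z * ∑ i, f i z < P z * (N * b / 2) := by
        calc _ ≤ _ := h1
          _ < √M * (N * b / (2 * √M) * P z) := by gcongr
          _ = _ := by field_simp
      have h3 : ∑ i, f i z < N * b / 2 := lt_of_mul_lt_mul_left h2 (hP z)
      have h4 : (N * b / 2) ^ 2 ≤ (∑ i, f i z - N * b) ^ 2 := by
        rw [← neg_sq (∑ i, f i z - N * b)]
        exact pow_le_pow_left₀ (by positivity) (by linarith) 2
      calc P z = 4 / (N * b) ^ 2 * (P z * (N * b / 2) ^ 2) := by field_simp; ring
        _ ≤ _ := by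
          have := hP z
          gcongr
    · have := hP z
      positivity
  calc _ ≤ ∑ z, 4 / (N * b) ^ 2 * (P z * (∑ i, f i z - N * b) ^ 2) :=
        Finset.sum_le_sum fun z _ => hpt z
    _ = 4 / (N * b) ^ 2 * ∑ z, P z * (∑ i, f i z - N * b) ^ 2 := by rw [Finset.mul_sum]
    _ ≤ 4 / (N * b) ^ 2 * (6 * δ * (N * b) ^ 2) := by gcongr
    _ = 24 * δ := by field_simp; ring

/-- Markov's inequality for a power `s` of the likelihood ratio. -/
theorem sum_tail_le (P Q : Ω → ℝ) (hP : ∀ z, 0 ≤ P z) (hQ : ∀ z, 0 ≤ Q z) {M s : ℝ} (hM : 0 < M)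
    (hs : 0 ≤ s) :
    ∑ z, (if M * P z < Q z then √(P z * Q z) else 0) ≤ M ^ (-s) * ∑ z, tilt s (P z) (Q z) := by
  rw [Finset.mul_sum]
  refine Finset.sum_le_sum fun z _ => ?_
  have hnn : 0 ≤ M ^ (-s) * tilt s (P z) (Q z) :=
    mul_nonneg (Real.rpow_nonneg hM.le _) (tilt_nonneg (hP z) (hQ z))
  split_ifs with h
  · rcases (hP z).eq_or_lt with h0 | h0
    · rw [← h0] at hnn ⊢
      simpa using hnn
    · have hq : 0 < Q z := lt_trans (mul_pos hM h0) h
      have h1 : tilt s (P z) (Q z) = √(P z * Q z) * (Q z / P z) ^ s := by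
        rw [← tilt_zero_eq_sqrt h0.le, tilt, tilt, Real.div_rpow hq.le h0.le, Real.rpow_sub h0,
          Real.rpow_add hq]
        simp only [sub_zero, add_zero]
        ring
      have h2 : M ^ s ≤ (Q z / P z) ^ s :=
        Real.rpow_le_rpow hM.le (by rw [le_div_iff₀ h0]; exact h.le) hs
      rw [h1, Real.rpow_neg hM.le]
      have h3 : 0 < M ^ s := Real.rpow_pos_of_pos hM s
      calc √(P z * Q z) = (M ^ s)⁻¹ * (√(P z * Q z) * M ^ s) := by field_simp
        _ ≤ _ := by gcongr
  · exact hnn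

end SecondMoment

/-! ### Converse -/

/-- The label vector `x` with the label `i` flipped. -/
def flipLabel (x : Labels m) (i : Fin m) : Labels m := Function.update x i (-x i)

theorem flipLabel_apply (x : Labels m) (i j : Fin m) :
    flipLabel x i j = if j = i then -x j else x j := by
  unfold flipLabel
  by_cases h : j = i
  · subst h; simp
  · simp [h]

theorem diffSet_comm (x v : Labels m) : diffSet x v = diffSet v x := by
  simp [diffSet, ne_comm]

theorem diffSet_flipLabel (x : Labels m) (i : Fin m) : diffSet x (flipLabel x i) = {i} := by
  ext j
  rw [diffSet, Finset.mem_filter, Finset.mem_singleton, flipLabel_apply]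
  by_cases h : j = i <;> simp [h, units_ne_neg_self]

theorem diffSet_flipLabel_flipLabel (x : Labels m) {i j : Fin m} (hij : i ≠ j) :
    diffSet (flipLabel x i) (flipLabel x j) = {i, j} := by
  ext k
  rw [diffSet, Finset.mem_filter, Finset.mem_insert, Finset.mem_singleton, flipLabel_apply,
    flipLabel_apply]
  by_cases h : k = i <;> by_cases h' : k = j
  · exact absurd (h.symm.trans h') hij
  · simp [h, hij, (units_ne_neg_self _).symm]
  · simp [h', hij.symm, units_ne_neg_self]
  · simp [h, h']

theorem flipLabel_injective (x : Labels m) : Function.Injective (flipLabel x) := by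
  intro i j h
  have h1 := diffSet_flipLabel x i
  rw [h, diffSet_flipLabel, Finset.singleton_inj] at h1
  exact h1.symm

theorem sum_likelihood (h : Admissible D Φ w ε lam) (hDm : D ≤ m) (x : Labels m) :
    ∑ z : Data m w n, likelihood D Φ ε x z = 1 := by
  have h1 := sum_tilt_likelihood (n := n) h 0 x x
  have h2 : diffSet x x = ∅ := by simp [diffSet]
  rw [chernoffSum_eq h hDm le_rfl, h2] at h1
  simp only [tilt_zero_eq_sqrt (likelihood_nonneg h _ _),
    Real.sqrt_mul_self (likelihood_nonneg h _ _)] at h1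
  simpa [oddFraction] using h1

/-- If under every ground truth `x` the label vectors at distance one from `x` have a total
likelihood of at least `K` times that of `x`, except with probability `p`, then no estimator
succeeds with probability more than `p + 1 / K`. -/
theorem le_avgErrorProb (h : Admissible D Φ w ε lam) (hDm : D ≤ m) {K p : ℝ} (hK : 0 < K)
    (hbad : ∀ x : Labels m, ∑ z : Data m w n,
      (if ∑ i, likelihood D Φ ε (flipLabel x i) z < K * likelihood D Φ ε x z
        then likelihood D Φ ε x z else 0) ≤ p)
    (est : Data m w n → Labels m) :
    1 - p - 1 / K ≤ avgErrorProb D Φ ε est := by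
  have hcard : (Fintype.card (Labels m) : ℝ) = 2 ^ m := by simp
  have hone : ∑ z : Data m w n, ∑ x, likelihood D Φ ε x z = 2 ^ m := by
    rw [Finset.sum_comm]
    simp only [sum_likelihood h hDm]
    simp
  have hpt : ∀ z : Data m w n, likelihood D Φ ε (est z) z ≤
      ∑ x, (if ∑ i, likelihood D Φ ε (flipLabel x i) z < K * likelihood D Φ ε x z
        then likelihood D Φ ε x z else 0) + 1 / K * ∑ x, likelihood D Φ ε x z := by
    intro z
    have hL := fun x => likelihood_nonneg h x z
    have h1 := Finset.single_le_sum (f := fun x =>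
      if ∑ i, likelihood D Φ ε (flipLabel x i) z < K * likelihood D Φ ε x z
        then likelihood D Φ ε x z else 0)
      (fun x _ => by split_ifs; exacts [hL x, le_rfl]) (Finset.mem_univ (est z))
    have h2 : 0 ≤ ∑ x, likelihood D Φ ε x z := Finset.sum_nonneg fun x _ => hL x
    split_ifs at h1 with hz
    · have : 0 ≤ 1 / K * ∑ x, likelihood D Φ ε x z := by positivity
      linarith
    · have h3 : ∑ i, likelihood D Φ ε (flipLabel (est z) i) z ≤ ∑ x, likelihood D Φ ε x z := by
        rw [← Finset.sum_image (f := fun x => likelihood D Φ ε x z)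
          ((flipLabel_injective (est z)).injOn)]
        exact Finset.sum_le_sum_of_subset_of_nonneg (Finset.subset_univ _) fun x _ _ => hL x
      have h4 : likelihood D Φ ε (est z) z ≤ 1 / K * ∑ x, likelihood D Φ ε x z := by
        rw [one_div, inv_mul_eq_div, le_div_iff₀ hK, mul_comm]
        exact (not_lt.mp hz).trans h3
      linarith
  unfold avgErrorProb
  rw [sum_errorProb, Finset.sum_sub_distrib, hone, le_div_iff₀ (by positivity)]
  have h5 : ∑ z : Data m w n, likelihood D Φ ε (est z) z ≤ 2 ^ m * p + 1 / K * 2 ^ m := by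
    refine (Finset.sum_le_sum fun z _ => hpt z).trans ?_
    rw [Finset.sum_add_distrib, ← Finset.mul_sum, hone, Finset.sum_comm]
    refine add_le_add ?_ le_rfl
    refine (Finset.sum_le_sum fun x _ => hbad x).trans ?_
    rw [Finset.sum_const, Finset.card_univ, nsmul_eq_mul, hcard]
  linarith

/-- Likelihood ratios above `exp (η / 2 * L)` contribute little to the Bhattacharyya coefficient of
the data for label vectors that differ in a single label, if `n / m` is at most of order `L`. -/
theorem sum_sqrt_likelihood_tail_le (h : Admissible D Φ w ε lam) (hDm : D ≤ m)
    (hθm : rate D Φ ε / m ≤ 1 / 2) {η s L : ℝ} (hL : 0 ≤ L)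
    (hs : 0 < s) (hsl : s * Real.log (1 / lam) ≤ 1)
    (hsη : 8 * D * s * Real.log (1 / lam) ^ 2 ≤ η * lam ^ 2)
    (hn : (n : ℝ) / m ≤ L / lam ^ 2) {x v : Labels m} {i : Fin m} (hxv : diffSet x v = {i}) :
    ∑ z : Data m w n, (if Real.exp (η / 2 * L) * likelihood D Φ ε x z < likelihood D Φ ε v z
      then √(likelihood D Φ ε x z * likelihood D Φ ε v z) else 0) ≤
    Real.exp (-(s * η / 4 * L)) * (1 - rate D Φ ε / m) ^ n := by
  have hlam := h.pos_lam
  refine (sum_tail_le _ _ (likelihood_nonneg h x) (likelihood_nonneg h v) (Real.exp_pos _)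
    hs.le).trans ?_
  rw [sum_tilt_likelihood h]
  have h1 := chernoffSum_tilt_le h hDm hxv hs.le hsl
  set Λ := Real.log (1 / lam)
  set B := 1 - rate D Φ ε / m with hB
  have hBhalf : 1 / 2 ≤ B := by linarith
  have h2 : chernoffSum D Φ ε s x v ≤ B * Real.exp (2 * D * (s * Λ) ^ 2 / m) := by
    have h3 := Real.add_one_le_exp (2 * D * (s * Λ) ^ 2 / m)
    have h5 : 0 ≤ 2 * D * (s * Λ) ^ 2 / m := by positivity
    calc chernoffSum D Φ ε s x v ≤ B + D / m * (s * Λ) ^ 2 := h1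
      _ = B + 1 / 2 * (2 * D * (s * Λ) ^ 2 / m) := by ring
      _ ≤ B + B * (2 * D * (s * Λ) ^ 2 / m) := by gcongr
      _ = B * (2 * D * (s * Λ) ^ 2 / m + 1) := by ring
      _ ≤ _ := mul_le_mul_of_nonneg_left h3 (by linarith)
  have h3 : chernoffSum D Φ ε s x v ^ n ≤ B ^ n * Real.exp (s * η / 4 * L) := by
    refine (pow_le_pow_left₀ (chernoffSum_nonneg h s x v) h2 n).trans ?_
    rw [mul_pow, ← Real.exp_nat_mul]
    refine mul_le_mul_of_nonneg_left (Real.exp_le_exp.mpr ?_) (pow_nonneg (by linarith) _)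
    calc n * (2 * D * (s * Λ) ^ 2 / m) = n / m * (2 * D * (s * Λ) ^ 2) := by ring
      _ ≤ L / lam ^ 2 * (2 * D * (s * Λ) ^ 2) := by gcongr
      _ = L / lam ^ 2 * (s / 4) * (8 * D * s * Λ ^ 2) := by ring
      _ ≤ L / lam ^ 2 * (s / 4) * (η * lam ^ 2) := by gcongr
      _ = s * η / 4 * L := by field_simp
  calc _ ≤ Real.exp (η / 2 * L) ^ (-s) * (B ^ n * Real.exp (s * η / 4 * L)) := by gcongr
    _ = Real.exp (-(s * η / 4 * L)) * B ^ n := by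
        rw [← Real.exp_mul, mul_left_comm, ← Real.exp_add, mul_comm]
        ring_nf

/-- The Bhattacharyya coefficient of the data for label vectors that differ in two labels is hardly
larger than the square of the coefficient for a single label: few queries contain both labels. -/
theorem sum_sqrt_likelihood_le (h : Admissible D Φ w ε lam) (hDm : D ≤ m)
    (hθm : rate D Φ ε / m ≤ 1 / 2) {x v : Labels m} (hxv : (diffSet x v).card = 2) :
    ∑ z : Data m w n, √(likelihood D Φ ε x z * likelihood D Φ ε v z) ≤
      ((1 - rate D Φ ε / m) ^ n) ^ 2 * Real.exp (n * (8 * D ^ 2 * (2 + D) / m ^ 2)) := by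
  simp only [← tilt_zero_eq_sqrt (likelihood_nonneg h x _)]
  rw [sum_tilt_likelihood h]
  have h1 := chernoffSum_le h hDm x v
  have hθD := (rate_mem h).2
  rw [hxv] at h1
  set θ := rate D Φ ε
  set C : ℝ := 8 * D ^ 2 * (2 + D) with hC
  set B := 1 - θ / m with hB
  have h2 : chernoffSum D Φ ε 0 x v ≤ B ^ 2 * Real.exp (C / m ^ 2) := by
    have h4 : 2 * θ / m * (D * (2 + D) / m) ≤ B ^ 2 * (C / m ^ 2) := by
      have h5 : (1 / 2 : ℝ) ^ 2 ≤ B ^ 2 := pow_le_pow_left₀ (by norm_num) (by linarith) 2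
      have hC0 : 0 ≤ C / m ^ 2 := by positivity
      calc 2 * θ / m * (D * (2 + D) / m) ≤ 2 * D / m * (D * (2 + D) / m) := by gcongr
        _ = (1 / 2) ^ 2 * (C / m ^ 2) := by rw [hC]; ring
        _ ≤ _ := mul_le_mul_of_nonneg_right h5 hC0
    calc chernoffSum D Φ ε 0 x v ≤ 1 - 2 * θ / m * (1 - D * (2 + D) / m) := by
          exact_mod_cast h1
      _ = B ^ 2 - (θ / m) ^ 2 + 2 * θ / m * (D * (2 + D) / m) := by rw [hB]; ring
      _ ≤ B ^ 2 + B ^ 2 * (C / m ^ 2) := by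
          have := sq_nonneg (θ / m)
          linarith
      _ = B ^ 2 * (C / m ^ 2 + 1) := by ring
      _ ≤ _ := mul_le_mul_of_nonneg_left (Real.add_one_le_exp _) (sq_nonneg B)
  refine (pow_le_pow_left₀ (chernoffSum_nonneg h 0 x v) h2 n).trans_eq ?_
  rw [mul_pow, ← Real.exp_nat_mul, ← pow_mul, mul_comm 2 n, pow_mul]

/-- For `m` large, `η` small and at most `(1 - η)` times the threshold many queries, the second moment
bound applies with `M = m ^ (η / 2)` and `b = (1 - rate / m) ^ n`, which is at least
`m ^ (-(1 - η / 2))`. -/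
theorem half_le_avgErrorProb (h : Admissible D Φ w ε lam) {η s : ℝ} (hη : 0 < η) (hη1 : η ≤ 1 / 2)
    (hs : 0 < s) (hsl : s * Real.log (1 / lam) ≤ 1)
    (hsη : 8 * D * s * Real.log (1 / lam) ^ 2 ≤ η * lam ^ 2)
    (hDm : 4 * D ≤ η * m)
    (hm : 200 * (8 * D ^ 2 * (2 + D)) * Real.log m ≤ lam ^ 2 * m)
    (hm1 : Real.exp (-(s * η / 4 * Real.log m)) ≤ 1 / 100)
    (hm2 : Real.exp (-(η / 4 * Real.log m)) ≤ 1 / 100)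
    (hn : (n : ℝ) ≤ (1 - η) * threshold D Φ m ε)
    (est : Data m w n → Labels m) : 1 / 2 ≤ avgErrorProb D Φ ε est := by
  have hD : (1 : ℝ) ≤ D := by exact_mod_cast one_le_degree h
  have hm8 : (8 * D : ℝ) ≤ m := by nlinarith [(Nat.cast_nonneg m : (0 : ℝ) ≤ m)]
  have hDm' : D ≤ m := by
    have : (D : ℝ) ≤ m := by linarith
    exact_mod_cast this
  have hm0 : (0 : ℝ) < m := by linarith
  have hL : 0 ≤ Real.log m := Real.log_nonneg (by linarith)
  have hl2 : 0 < lam ^ 2 := pow_pos h.pos_lam 2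
  set θ := rate D Φ ε with hθ
  have hθ0 : 0 < θ := rate_pos h
  obtain ⟨hθl, hθD⟩ : lam ^ 2 ≤ θ ∧ θ ≤ D := rate_mem h
  set L := Real.log m with hLdef
  set Λ := Real.log (1 / lam)
  rw [threshold_eq h, ← hθ] at hn
  have hn1 : n * (θ / m) ≤ (1 - η) * L := by
    calc n * (θ / m) ≤ (1 - η) * (m * L / θ) * (θ / m) := by gcongr
      _ = (1 - η) * L := by field_simp
  have hn2 : n / m ≤ L / lam ^ 2 := by
    rw [div_le_div_iff₀ hm0 hl2]
    have h1 : n * θ ≤ (1 - η) * L * m := by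
      rw [← mul_div_assoc, div_le_iff₀ hm0] at hn1
      exact hn1
    calc n * lam ^ 2 ≤ n * θ := by gcongr
      _ ≤ (1 - η) * L * m := h1
      _ ≤ 1 * L * m := by gcongr; linarith
      _ = L * m := by ring
  -- The Bhattacharyya coefficient of one query for a single flipped label.
  set B := 1 - θ / m with hB
  have hθm : θ / m ≤ 1 / 8 := by
    rw [div_le_iff₀ hm0]; linarith
  have hθm0 : 0 < θ / m := by positivity
  have hBhalf : 1 / 2 ≤ B := by linarith
  have hB0 : 0 < B := by linarith
  set b := B ^ n with hb
  have hb0 : 0 < b := pow_pos hB0 n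
  have hblow : Real.exp (-((1 - η / 2) * L)) ≤ b := by
    have h1 : Real.exp (-(θ / m / B)) ≤ B := by
      rw [Real.exp_neg, inv_le_comm₀ (Real.exp_pos _) hB0]
      have h2 := Real.add_one_le_exp (θ / m / B)
      have h3 : B⁻¹ = θ / m / B + 1 := by
        rw [eq_comm, div_add_one hB0.ne', inv_eq_one_div]
        congr 1
        rw [hB]; ring
      linarith
    calc Real.exp (-((1 - η / 2) * L)) ≤ Real.exp (-(n * (θ / m / B))) := by
          refine Real.exp_le_exp.mpr (neg_le_neg ?_)
          rw [← mul_div_assoc, div_le_iff₀ hB0]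
          have h4 : θ / m ≤ η / 2 := by
            rw [div_le_iff₀ hm0]; linarith
          have h5 : 1 - η ≤ (1 - η / 2) * B := by nlinarith
          calc n * (θ / m) ≤ (1 - η) * L := hn1
            _ ≤ (1 - η / 2) * B * L := by gcongr
            _ = _ := by ring
      _ = Real.exp (-(θ / m / B)) ^ n := by rw [← Real.exp_nat_mul]; ring_nf
      _ ≤ b := pow_le_pow_left₀ (Real.exp_pos _).le h1 n
  set M := Real.exp (η / 2 * L) with hM
  have hM0 : 0 < M := Real.exp_pos _
  have hMs : √M = Real.exp (η / 4 * L) := by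
    rw [hM, ← Real.exp_half]
    ring_nf
  have hmb : 100 * √M ≤ m * b := by
    have h1 : Real.exp (η / 2 * L) ≤ m * b := by
      calc Real.exp (η / 2 * L) = Real.exp L * Real.exp (-((1 - η / 2) * L)) := by
            rw [← Real.exp_add]; ring_nf
        _ ≤ m * b := by
            rw [hLdef, Real.exp_log hm0]
            gcongr
    have h2 : √M = Real.exp (-(η / 4 * L)) * Real.exp (η / 2 * L) := by
      rw [hMs, ← Real.exp_add]; ring_nf
    rw [h2]
    nlinarith [Real.exp_pos (η / 2 * L)]
  have hMs0 : 0 < √M := Real.sqrt_pos.mpr hM0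
  have htail : ∀ x v : Labels m, ∀ i, diffSet x v = {i} →
      ∑ z : Data m w n, (if M * likelihood D Φ ε x z < likelihood D Φ ε v z
        then √(likelihood D Φ ε x z * likelihood D Φ ε v z) else 0) ≤ 1 / 100 * b := by
    intro x v i hxv
    refine (sum_sqrt_likelihood_tail_le h hDm' (by linarith) hL hs hsl hsη hn2 hxv).trans ?_
    gcongr
  have hoff : ∀ x v : Labels m, (diffSet x v).card = 2 →
      ∑ z : Data m w n, √(likelihood D Φ ε x z * likelihood D Φ ε v z) ≤
        (1 + 1 / 100) * b ^ 2 := by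
    intro x v hxv
    refine (sum_sqrt_likelihood_le h hDm' (by linarith) hxv).trans ?_
    rw [mul_comm]
    refine mul_le_mul_of_nonneg_right ?_ (sq_nonneg _)
    have h8 : n * (8 * D ^ 2 * (2 + D) / m ^ 2 : ℝ) ≤ 1 / 200 := by
      calc n * (8 * D ^ 2 * (2 + D) / m ^ 2 : ℝ) = n / m * (8 * D ^ 2 * (2 + D) / m) := by ring
        _ ≤ L / lam ^ 2 * (8 * D ^ 2 * (2 + D) / m) := by gcongr
        _ ≤ 1 / 200 := by
          rw [div_mul_div_comm, div_le_div_iff₀ (by positivity) (by norm_num)]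
          linarith
    have h9 : |(1 / 200 : ℝ)| ≤ 1 := by rw [abs_of_pos] <;> norm_num
    have h10 := (abs_le.mp (Real.abs_exp_sub_one_le h9)).2
    rw [abs_of_pos (by norm_num)] at h10
    have h11 := Real.exp_le_exp.mpr h8
    linarith
  have hK : 8 ≤ (Fintype.card (Fin m) : ℝ) * b / (2 * √M) := by
    rw [Fintype.card_fin, le_div_iff₀ (by positivity)]
    linarith
  have hfinal := le_avgErrorProb (K := (Fintype.card (Fin m) : ℝ) * b / (2 * √M))
    (p := 24 * (1 / 100)) h hDm' (by linarith) (fun x => ?_) est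
  · have h1 : 1 / ((Fintype.card (Fin m) : ℝ) * b / (2 * √M)) ≤ 1 / 8 :=
      one_div_le_one_div_of_le (by norm_num) hK
    linarith
  · refine sum_lt_of_secondMoment (fun z => likelihood D Φ ε x z)
      (fun i z => likelihood D Φ ε (flipLabel x i) z) (likelihood_nonneg h x)
      (fun i => likelihood_nonneg h _) (sum_likelihood h hDm' x) hM0 hb0 ?_ ?_ ?_ (by norm_num)
      ?_ ?_ ?_
    · rw [Fintype.card_fin]; exact_mod_cast hm0
    · intro i
      simp only [← tilt_zero_eq_sqrt (likelihood_nonneg h x _)]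
      rw [sum_tilt_likelihood h, chernoffSum_of_diffSet_singleton h hDm' (diffSet_flipLabel x i)]
    · intro i j hij
      exact hoff _ _ (by rw [diffSet_flipLabel_flipLabel x hij, Finset.card_pair hij])
    · exact fun i => htail _ _ i (diffSet_flipLabel x i)
    · exact fun i => htail _ _ i (by rw [diffSet_comm, diffSet_flipLabel])
    · rw [Fintype.card_fin]; linarith

theorem threshold_nonneg (h : Admissible D Φ w ε lam) (m : ℕ) : 0 ≤ threshold D Φ m ε := by
  rw [threshold_eq h]
  have := rate_pos h
  have := Real.log_natCast_nonneg m
  positivity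

theorem eventually_lt_of_tendsto_avgErrorProb {w : ℕ → ℕ} {ε : ∀ m, Fin (w m) → ℕ → ℝ}
    (h : ∀ m, Admissible D Φ (w m) (ε m) lam) {η : ℝ} (hη : 0 < η) {n : ℕ → ℕ}
    {est : ∀ m, Data m (w m) (n m) → Labels m}
    (hest : Tendsto (fun m => avgErrorProb D Φ (ε m) (est m)) atTop (𝓝 0)) :
    ∀ᶠ m in atTop, (1 - η) * threshold D Φ m (ε m) < (n m : ℝ) := by
  have hl := (h 0).pos_lam
  have hl2 : 0 < lam ^ 2 := pow_pos hl 2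
  have hD : (1 : ℝ) ≤ D := by exact_mod_cast one_le_degree (h 0)
  have hl1 : lam ≤ 1 := by
    have hb := (h 0).bounds ⟨0, (h 0).pos_workers⟩ 1
      (Finset.mem_Icc.mpr ⟨le_rfl, one_le_degree (h 0)⟩)
    linarith [hb.1, hb.2]
  -- The threshold is nonnegative, so it is enough to treat small `η`.
  set η' := min η (1 / 2) with hη'
  have hη0 : 0 < η' := lt_min hη (by norm_num)
  have hη1 : η' ≤ 1 / 2 := min_le_right _ _
  set Λ := Real.log (1 / lam) with hΛ
  have hΛ0 : 0 ≤ Λ := Real.log_nonneg (by rw [le_div_iff₀ hl]; linarith)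
  set s := η' * lam ^ 2 / (8 * D * (1 + Λ) ^ 2) with hs
  have hs0 : 0 < s := by positivity
  have hsη : 8 * D * s * Λ ^ 2 ≤ η' * lam ^ 2 := by
    calc 8 * D * s * Λ ^ 2 ≤ 8 * D * s * (1 + Λ) ^ 2 := by gcongr; linarith
      _ = η' * lam ^ 2 := by rw [hs]; field_simp
  have hsl : s * Λ ≤ 1 := by
    rw [hs, div_mul_eq_mul_div, div_le_one (by positivity)]
    calc η' * lam ^ 2 * Λ ≤ 1 * 1 * Λ := by
          gcongr
          · linarith
          · exact pow_le_one₀ hl.le hl1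
      _ ≤ 8 * D * (1 + Λ) ^ 2 := by nlinarith
  have hlog := tendsto_log_natCast
  have hexp : ∀ c : ℝ, 0 < c →
      ∀ᶠ m : ℕ in atTop, Real.exp (-(c * Real.log m)) ≤ 1 / 100 := by
    intro c hc
    have h1 : Tendsto (fun m : ℕ => Real.exp (-(c * Real.log m))) atTop (𝓝 0) :=
      Real.tendsto_exp_neg_atTop_nhds_zero.comp (hlog.const_mul_atTop hc)
    exact h1.eventually_le_const (by norm_num)
  have hlittle : ∀ C : ℝ, 0 < C → ∀ᶠ m : ℕ in atTop, C * Real.log m ≤ lam ^ 2 * m := by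
    intro C hC
    have h1 := (Real.isLittleO_log_id_atTop.comp_tendsto tendsto_natCast_atTop_atTop).def
      (div_pos hl2 hC)
    filter_upwards [h1] with m hm
    simp only [Function.comp_apply, id, Real.norm_eq_abs, Nat.abs_cast] at hm
    have h2 := (le_abs_self _).trans hm
    calc C * Real.log m ≤ C * (lam ^ 2 / C * m) := by gcongr
      _ = lam ^ 2 * m := by field_simp
  filter_upwards [hest.eventually_lt_const (show (0 : ℝ) < 1 / 2 by norm_num),
    (tendsto_natCast_atTop_atTop.const_mul_atTop hη0).eventually_ge_atTop (4 * D : ℝ),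
    hlittle (200 * (8 * D ^ 2 * (2 + D))) (by positivity), hexp (s * η' / 4) (by positivity),
    hexp (η' / 4) (by positivity)] with m h1 h2 h3 h4 h5
  by_contra hcon
  refine h1.not_ge (half_le_avgErrorProb (h m) hη0 hη1 hs0 hsl hsη h2 h3 h4 h5 ?_ (est m))
  refine (not_lt.mp hcon).trans (mul_le_mul_of_nonneg_right ?_ (threshold_nonneg (h m) m))
  linarith [min_le_left η (1 / 2)]

end XorQuery

theorem theorem1 (D : ℕ) (Φ : ℕ → ℝ) (hΦ : ∀ d ∈ Finset.Icc 1 D, 0 ≤ Φ d)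
    (hΦ_sum : ∑ d ∈ Finset.Icc 1 D, Φ d = 1)
    (hΦ_odd : 0 < ∑ d ∈ (Finset.Icc 1 D).filter (fun d => Odd d), Φ d)
    (w : ℕ → ℕ) (hw : ∀ m, 0 < w m) (ε : ∀ m, Fin (w m) → ℕ → ℝ)
    (hε : XorQuery.NoiseBounded D w ε) (η : ℝ) (hη : 0 < η) :
    -- ML estimators minimize the error probability (for a uniform ground truth)
    (∀ (m n : ℕ) (ml est : XorQuery.Data m (w m) n → XorQuery.Labels m),
      XorQuery.IsML D Φ (ε m) ml →
      XorQuery.avgErrorProb D Φ (ε m) ml ≤ XorQuery.avgErrorProb D Φ (ε m) est) ∧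
    -- ML achieves strong recovery, whatever the ground truth, if `n ≥ (1 + η) threshold`
    (∀ (n : ℕ → ℕ) (ml : ∀ m, XorQuery.Data m (w m) (n m) → XorQuery.Labels m),
      (∀ m, XorQuery.IsML D Φ (ε m) (ml m)) →
      (∀ᶠ m in atTop, (1 + η) * XorQuery.threshold D Φ m (ε m) ≤ (n m : ℝ)) →
      Tendsto (fun m => ⨆ x : XorQuery.Labels m, XorQuery.errorProb D Φ (ε m) (ml m) x)
        atTop (𝓝 0)) ∧
    -- no estimator achieves strong recovery, even for a uniform ground truth, unless
    -- eventually `n > (1 - η) threshold`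
    (∀ (n : ℕ → ℕ) (est : ∀ m, XorQuery.Data m (w m) (n m) → XorQuery.Labels m),
      Tendsto (fun m => XorQuery.avgErrorProb D Φ (ε m) (est m)) atTop (𝓝 0) →
      ∀ᶠ m in atTop, (1 - η) * XorQuery.threshold D Φ m (ε m) < (n m : ℝ)) := by
  obtain ⟨lam, hlam, hbounds⟩ := hε
  have h : ∀ m, XorQuery.Admissible D Φ (w m) (ε m) lam := fun m =>
    ⟨hΦ, hΦ_sum, hw m, hlam, hbounds m⟩
  exact ⟨fun m n ml est hml => XorQuery.avgErrorProb_le_of_isML hml est,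
    fun n ml hml hn => XorQuery.tendsto_iSup_errorProb h hΦ_odd hη hml hn,
    fun n est hest => XorQuery.eventually_lt_of_tendsto_avgErrorProb h hη hest⟩
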